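/- Let $d\ge 1$, let $S$ be the space of real symmetric $d\times d$ matrices with the scalar product $\langle \mathbf E,\mathbf C\rangle=\sum_{i,j}E_{ij}C_{ij}$, and let $\rho>0$. Let $\mathsf G$ be a function on $]0,\infty[$ whose values are symmetric linear operators on $S$, such that * $\mathsf G$ is completely monotonic: for every $\mathbf E\in S$ the function $f(t)=\langle \mathbf E,\mathsf G(t)\,\mathbf E\rangle$ is infinitely differentiable on $]0,\infty[$ and $(-1)^m f^{(m)}(t)\ge 0$ for all $m\ge 0$, $t>0$; * the limit $\lim_{t\to 0+}\mathsf G(t)$ exists and is finite; * the medium is a viscoelastic solid: $\mathsf G^\infty=\lim_{t\to\infty}\mathsf G(t)$ is positive definite. Let $\mathsf Q(p)=p\int_0^\infty e^{-pt}\,\mathsf G(t)\,\mathrm dt$, with Cartesian components $Q_{ijkl}(p)$ (so $(\mathsf Q(p)\mathbf E)_{ij}=\sum_{k,l}Q_{ijkl}(p)E_{kl}$ and $Q_{ijkl}=Q_{ijlk}$). For a unit vector $\mathbf n\in\mathbb R^d$ let $\mathbf Q_{\mathbf n}(p)$ be the matrix with entries $Q_{\mathbf n;ik}(p)=\sum_{j,l}Q_{ijkl}(p)\,n_j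 n_l$, and let $$\mathbf K_{\mathbf n}(p)=\rho^{1/2}\,p\,\mathbf Q_{\mathbf n}(p)^{-1/2}\quad(p>0),\qquad \mathbf K_{\mathbf n}(0)=0,$$ where $\mathbf Q_{\mathbf n}(p)^{1/2}$ is the principal square root, i.e. the square root all of whose eigenvalues lie in the open right half-plane. Then for every unit vector $\mathbf n$: for all $p>0$ the integral defining $\mathsf Q(p)$ converges absolutely and $\mathbf Q_{\mathbf n}(p)$ has a principal square root, so that $\mathbf K_{\mathbf n}(p)$ is well defined; and $\mathbf K_{\mathbf n}$ is a matrix-valued complete Bernstein function. The latter means that $\mathbf K_{\mathbf n}(p)$ is a real matrix for $p\ge 0$; that $\mathbf K_{\mathbf n}$ has an analytic continuation $\mathbf F$ from $]0,\infty[$ to $\mathbb C\setminus\,]-\infty,0]$ with $\Im z\,\Im\mathbf F(z)\ge 0$ (positive semi-definite) for all $z$ there, where $\Im\mathbf B=(\mathbf B-\mathbf B^\dagger)/(2\mathrm i)$; and that $\lim_{p\to 0+}\mathbf K_{\mathbf n}(p)$ exists, equals $\mathbf K_{\mathbf n}(0)$, and is real and positive semi-definite. -/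

import Mathlib

open MeasureTheory Set Filter Topology ComplexStarModule
open scoped ContDiff ComplexOrder

noncomputable section

/-- A function on `]0,∞[` is completely monotonic: it is smooth there and its `m`-th derivative has
the sign `(-1)^m` for every `m ≥ 0`. -/
def IsCompletelyMonotonic (f : ℝ → ℝ) : Prop :=
  ContDiffOn ℝ ∞ f (Ioi 0) ∧
    ∀ (m : ℕ) (t : ℝ), 0 < t → 0 ≤ (-1 : ℝ) ^ m * iteratedDerivWithin m f (Ioi 0) t

/-- The space `S` of real symmetric rank-2 tensors, i.e. of real symmetric `d × d` matrices. -/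
def SymTensor (d : ℕ) : Submodule ℝ (Matrix (Fin d) (Fin d) ℝ) where
  carrier := {E | E.IsSymm}
  add_mem' hE hC := hE.add hC
  zero_mem' := Matrix.isSymm_zero
  smul_mem' c _ hE := hE.smul c

/-- The scalar product `⟨E, C⟩ = ∑ E_ij C_ij` on `S`. -/
def symDot {d : ℕ} (E C : SymTensor d) : ℝ :=
  ∑ i, ∑ j, (E : Matrix (Fin d) (Fin d) ℝ) i j * (C : Matrix (Fin d) (Fin d) ℝ) i j

/-- A relaxation modulus of a viscoelastic solid: a function on `]0,∞[` (values at `t ≤ 0` are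
irrelevant) whose values are symmetric operators on `S`, completely monotonic in the sense that
`t ↦ ⟨E, G(t) E⟩` is completely monotonic for every `E`, with a finite limit at `0+`, and with a
positive definite limit at infinity. -/
structure IsSolidRelaxationModulus {d : ℕ} (G : ℝ → SymTensor d →ₗ[ℝ] SymTensor d) : Prop where
  symm : ∀ t, 0 < t → ∀ E C, symDot E (G t C) = symDot C (G t E)
  completelyMonotonic : ∀ E, IsCompletelyMonotonic fun t => symDot E (G t E)
  finite_at_zero : ∃ G₀ : SymTensor d →ₗ[ℝ] SymTensor d,
    ∀ E, Tendsto (fun t => G t E) (𝓝[>] 0) (𝓝 (G₀ E))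
  solid : ∃ Ginf : SymTensor d →ₗ[ℝ] SymTensor d,
    (∀ E, Tendsto (fun t => G t E) atTop (𝓝 (Ginf E))) ∧ ∀ E, E ≠ 0 → 0 < symDot E (Ginf E)

/-- The symmetrized unit dyad `(e_k ⊗ e_l + e_l ⊗ e_k) / 2`. -/
def symDyad {d : ℕ} (k l : Fin d) : SymTensor d :=
  ⟨(1 / 2 : ℝ) • (Matrix.single k l 1 + Matrix.single l k 1), by
    change Matrix.IsSymm _
    refine Matrix.IsSymm.smul ?_ _
    rw [Matrix.IsSymm, Matrix.transpose_add, Matrix.transpose_single, Matrix.transpose_single,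
      add_comm]⟩

/-- The Cartesian components `H_ijkl` of an operator on `S`: the coefficients with the symmetry
`H_ijkl = H_ijlk` for which `(H E)_ij = ∑ H_ijkl E_kl`. -/
def component {d : ℕ} (H : SymTensor d →ₗ[ℝ] SymTensor d) (i j k l : Fin d) : ℝ :=
  (H (symDyad k l) : Matrix (Fin d) (Fin d) ℝ) i j

/-- The components of `Q(p) = p ∫_0^∞ e^{-pt} G(t) dt`. -/
def laplaceModulus {d : ℕ} (G : ℝ → SymTensor d →ₗ[ℝ] SymTensor d) (p : ℂ) (i j k l : Fin d) : ℂ :=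
  p * ∫ t in Ioi (0 : ℝ), Complex.exp (-p * t) * (component (G t) i j k l : ℂ)

/-- The matrix `Q_n(p)` with the entries `∑_{j,l} Q_ijkl(p) n_j n_l`. -/
def projectedModulus {d : ℕ} (G : ℝ → SymTensor d →ₗ[ℝ] SymTensor d)
    (n : EuclideanSpace ℝ (Fin d)) (p : ℂ) : Matrix (Fin d) (Fin d) ℂ :=
  Matrix.of fun i k => ∑ j, ∑ l, laplaceModulus G p i j k l * (n j : ℂ) * (n l : ℂ)

/-- `Y` is a principal square root of `B`: `Y² = B` and all the eigenvalues of `Y` lie in the open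
right half-plane. There is at most one such `Y`. -/
def IsPrincipalSqrt {d : ℕ} (B Y : Matrix (Fin d) (Fin d) ℂ) : Prop :=
  Y * Y = B ∧ ∀ μ ∈ spectrum ℂ Y, 0 < μ.re

open Classical in
/-- The principal square root of `B` (zero, by convention, if there is none). -/
def principalSqrt {d : ℕ} (B : Matrix (Fin d) (Fin d) ℂ) : Matrix (Fin d) (Fin d) ℂ :=
  if h : ∃ Y, IsPrincipalSqrt B Y then h.choose else 0

/-- The wavenumber function `K_n(p) = ρ^{1/2} p Q_n(p)^{-1/2}`. Its value at `p = 0` is `0`. -/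
def wavenumber {d : ℕ} (ρ : ℝ) (G : ℝ → SymTensor d →ₗ[ℝ] SymTensor d)
    (n : EuclideanSpace ℝ (Fin d)) (p : ℂ) : Matrix (Fin d) (Fin d) ℂ :=
  (((Real.sqrt ρ : ℝ) : ℂ) * p) • (principalSqrt (projectedModulus G n p))⁻¹

/-- A function `A` on `[0,∞[` (values at `x < 0` are irrelevant) with values in the real `d × d`
matrices is a matrix-valued complete Bernstein function: it has an analytic continuation `F` to
`ℂ ∖ ]-∞,0]` such that `Im z Im F(z) ≥ 0`, where `Im B = (B - Bᴴ) / 2i`, and its limit at `0+`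
exists, is the value `A 0`, and is real positive semi-definite. -/
def IsMatrixCBF {d : ℕ} (A : ℝ → Matrix (Fin d) (Fin d) ℂ) : Prop :=
  (∀ x, 0 ≤ x → ∀ i j, (A x i j).im = 0) ∧
  (∃ F : ℂ → Matrix (Fin d) (Fin d) ℂ,
    (∀ i j, DifferentiableOn ℂ (fun z => F z i j) Complex.slitPlane) ∧
    (∀ x : ℝ, 0 < x → F x = A x) ∧
    ∀ z ∈ Complex.slitPlane, (z.im • (ℑ (F z) : Matrix (Fin d) (Fin d) ℂ)).PosSemidef) ∧
  Tendsto A (𝓝[>] 0) (𝓝 (A 0)) ∧ (A 0).PosSemidef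

end

/-! For a positive definite matrix `B`, `∫ (u² + B)⁻¹ du = π B^{-1/2}` over the real line. The
wavenumber function is therefore a positive multiple of `∫ p (u² + Q_n(p))⁻¹ du`, and it suffices to
continue `Q_n` to the slit plane so that each `z (u² + Q_n(z))⁻¹` has imaginary part of the sign of
`Im z`.

The continuation comes from the scalar functions `⟨E, G(t) E⟩`. Integrating Taylor's remainder from
infinity writes such a function, minus its limit `b`, as a mixture of truncated powers `(1 -
t/s)₊^m` against a positive density of mass `a - b`. Multiplied by `p`, the Laplace transform of a
truncated power is within `1/m` of `p / (p + m/s)`, a kernel that extends to the slit plane, where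
it is bounded locally uniformly in `m` and `s` and takes values between the directions of `1` and
`z`. An ultrafilter limit in `m` yields the continuation (`IsCMSequence.exists_continuation`) with
two sector inequalities: rotated by `-arg z / 2`, the values have real part bounded below through
`b`, and their argument does not pass that of `z`.

Polarization and the identity theorem assemble these scalar functions into a matrix family
(`exists_isSectorialFamily`). The first inequality, coercive because the limit modulus is positive
definite, makes `u² + Q(z)` invertible with inverse of order `(u² + γ)⁻¹`; hence the resolvent
integral converges and is holomorphic, and `K_n(p) = O(p)` at the origin. The second inequality
gives the sign of the imaginary part (`IsSectorialFamily.isMatrixCBF`). -/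

open scoped ComplexConjugate

/-! ### Completely monotonic functions: Taylor's formula from infinity. -/

/-- A sequence `g` of nonnegative functions on `]0,∞[` with `g n' = -g (n+1)`, together with the
limits of `g 0` at `0` and at infinity. -/
structure IsCMSequence (g : ℕ → ℝ → ℝ) (a b : ℝ) : Prop where
  nonneg : ∀ n t, 0 < t → 0 ≤ g n t
  hasDerivAt : ∀ n t, 0 < t → HasDerivAt (g n) (-g (n + 1) t) t
  tendsto_zero : Tendsto (g 0) (𝓝[>] 0) (𝓝 a)
  tendsto_atTop : Tendsto (g 0) atTop (𝓝 b)

theorem IsCompletelyMonotonic.isCMSequence {f : ℝ → ℝ} (hf : IsCompletelyMonotonic f) {a b : ℝ}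
    (ha : Tendsto f (𝓝[>] 0) (𝓝 a)) (hb : Tendsto f atTop (𝓝 b)) :
    IsCMSequence (fun n t => (-1 : ℝ) ^ n * iteratedDerivWithin n f (Ioi 0) t) a b where
  nonneg n t ht := hf.2 n t ht
  hasDerivAt n t ht := by
    have h1 : DifferentiableAt ℝ (iteratedDerivWithin n f (Ioi 0)) t :=
      (hf.1.differentiableOn_iteratedDerivWithin (by exact_mod_cast WithTop.coe_lt_top n)
        (uniqueDiffOn_Ioi 0) t ht).differentiableAt (Ioi_mem_nhds ht)
    have h2 := (h1.hasDerivAt).const_mul ((-1 : ℝ) ^ n)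
    refine h2.congr_deriv ?_
    rw [iteratedDerivWithin_succ, derivWithin_of_isOpen isOpen_Ioi ht, pow_succ]
    ring
  tendsto_zero := by simpa using ha
  tendsto_atTop := by simpa using hb

namespace IsCMSequence
variable {g : ℕ → ℝ → ℝ} {a b : ℝ}

theorem continuousOn (h : IsCMSequence g a b) (n : ℕ) : ContinuousOn (g n) (Ioi 0) :=
  fun t ht => (h.hasDerivAt n t ht).continuousAt.continuousWithinAt

theorem antitoneOn (h : IsCMSequence g a b) (n : ℕ) : AntitoneOn (g n) (Ioi 0) := by
  refine antitoneOn_of_deriv_nonpos (convex_Ioi 0) (h.continuousOn n) ?_ ?_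
  · rw [interior_Ioi]
    exact fun t ht => (h.hasDerivAt n t ht).differentiableAt.differentiableWithinAt
  · rw [interior_Ioi]
    intro t ht
    rw [(h.hasDerivAt n t ht).deriv]
    exact neg_nonpos.2 (h.nonneg _ t ht)

theorem le_left (h : IsCMSequence g a b) {t : ℝ} (ht : 0 < t) : g 0 t ≤ a := by
  refine ge_of_tendsto h.tendsto_zero ?_
  filter_upwards [Ioo_mem_nhdsGT ht] with s hs
  exact h.antitoneOn 0 hs.1 ht hs.2.le

theorem right_le (h : IsCMSequence g a b) {t : ℝ} (ht : 0 < t) : b ≤ g 0 t := by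
  refine le_of_tendsto h.tendsto_atTop ?_
  filter_upwards [Ici_mem_atTop t] with s hs
  exact h.antitoneOn 0 ht (lt_of_lt_of_le ht hs) hs

/-- Mean value theorem on `[s/2, s]`, with the slope bounded below by its value at the right
endpoint because `g (n + 1)` decreases. -/
theorem half_mul_le (h : IsCMSequence g a b) (n : ℕ) {s : ℝ} (hs : 0 < s) :
    s / 2 * g (n + 1) s ≤ g n (s / 2) - g n s := by
  have hs2 : s / 2 < s := by linarith
  obtain ⟨c, hc, hc'⟩ := exists_hasDerivAt_eq_slope (g n) (fun t => -g (n + 1) t) hs2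
    ((h.continuousOn n).mono fun t ht => lt_of_lt_of_le (half_pos hs) ht.1)
    (fun t ht => h.hasDerivAt n t (lt_trans (half_pos hs) ht.1))
  have hc0 : 0 < c := lt_trans (half_pos hs) hc.1
  have h1 := h.antitoneOn (n + 1) hc0 hs hc.2.le
  rw [eq_div_iff (by linarith)] at hc'
  nlinarith

/-- Makes the boundary terms of Taylor's formula vanish. The halving hypothesis on `l` covers both
`0+` and infinity; `half_mul_le` then trades each derivative for a difference of values at `s/2` and
`s`, which tends to zero by induction. -/
theorem tendsto_pow_mul (h : IsCMSequence g a b) {l : Filter ℝ} {c : ℝ}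
    (hl : Tendsto (fun s : ℝ => s / 2) l l) (hpos : ∀ᶠ s in l, 0 < s) (hc : Tendsto (g 0) l (𝓝 c))
    (n : ℕ) : Tendsto (fun s => s ^ (n + 1) * g (n + 1) s) l (𝓝 0) := by
  have key : ∀ n : ℕ, Tendsto (fun s : ℝ => s ^ n * (g n (s / 2) - g n s)) l (𝓝 0) →
      Tendsto (fun s => s ^ (n + 1) * g (n + 1) s) l (𝓝 0) := by
    intro n hn
    refine squeeze_zero' ?_ ?_ (by simpa using hn.const_mul 2)
    · filter_upwards [hpos] with s hs
      have := h.nonneg (n + 1) s hs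
      positivity
    · filter_upwards [hpos] with s hs
      have := mul_le_mul_of_nonneg_left (h.half_mul_le n hs) (pow_pos hs n).le
      rw [pow_succ]
      linarith
  induction n with
  | zero =>
    refine key 0 ?_
    simpa using (hc.comp hl).sub hc
  | succ n ih =>
    refine key (n + 1) ?_
    have h1 := ((ih.comp hl).const_mul (2 ^ (n + 1))).sub ih
    simp only [mul_zero, sub_zero] at h1
    refine h1.congr fun s => ?_
    simp only [Function.comp, div_pow]
    field_simp

/-- The density `s ^ n * g (n + 1) s / n!`. -/
noncomputable def _root_.cmDensity (g : ℕ → ℝ → ℝ) (n : ℕ) (s : ℝ) : ℝ :=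
  s ^ n / n.factorial * g (n + 1) s

/-- The Taylor polynomial of `g 0` about `s` evaluated at `t`, viewed as a function of the centre
`s`; its derivative telescopes to the remainder integrand. -/
noncomputable def _root_.taylorSum (g : ℕ → ℝ → ℝ) (t : ℝ) (n : ℕ) (s : ℝ) : ℝ :=
  ∑ k ∈ Finset.range (n + 1), (s - t) ^ k / k.factorial * g k s

theorem hasDerivAt_taylorSum (h : IsCMSequence g a b) (t : ℝ) (n : ℕ) {s : ℝ} (hs : 0 < s) :
    HasDerivAt (taylorSum g t n) (-((s - t) ^ n / n.factorial * g (n + 1) s)) s := by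
  induction n with
  | zero =>
    have h0 : taylorSum g t 0 = g 0 := by ext s; simp [taylorSum]
    rw [h0]
    simpa using h.hasDerivAt 0 s hs
  | succ n ih =>
    have h0 : taylorSum g t (n + 1) = fun s => taylorSum g t n s +
        (s - t) ^ (n + 1) / (n + 1).factorial * g (n + 1) s := by
      ext s
      rw [taylorSum, Finset.sum_range_succ, taylorSum]
    rw [h0]
    have h1 : HasDerivAt (fun s : ℝ => (s - t) ^ (n + 1) / (n + 1).factorial)
        ((s - t) ^ n / n.factorial) s := by
      have h2 := (((hasDerivAt_id s).sub_const t).pow (n + 1)).div_const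
        ((n + 1).factorial : ℝ)
      refine h2.congr_deriv ?_
      rw [Nat.factorial_succ]
      have : (n.factorial : ℝ) ≠ 0 := by positivity
      have : (n + 1 : ℝ) ≠ 0 := by positivity
      push_cast
      field_simp
      simp
    exact (ih.add (h1.mul (h.hasDerivAt (n + 1) s hs))).congr_deriv (by ring)

theorem tendsto_taylorSum (h : IsCMSequence g a b) (t : ℝ) (n : ℕ) :
    Tendsto (taylorSum g t n) atTop (𝓝 b) := by
  have h1 : ∀ k : ℕ, Tendsto (fun s => (s - t) ^ (k + 1) / (k + 1).factorial * g (k + 1) s) atTop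
      (𝓝 0) := by
    intro k
    have h2 : Tendsto (fun s : ℝ => (1 - t / s) ^ (k + 1) / (k + 1).factorial) atTop
        (𝓝 ((1 - 0) ^ (k + 1) / (k + 1).factorial)) :=
      ((tendsto_const_nhds.sub (tendsto_const_nhds.div_atTop tendsto_id)).pow _).div_const _
    have h3 := h2.mul (h.tendsto_pow_mul (l := atTop) (tendsto_id.atTop_div_const (by norm_num))
      (eventually_gt_atTop 0) h.tendsto_atTop k)
    rw [mul_zero] at h3
    refine h3.congr' ?_
    filter_upwards [eventually_gt_atTop 0] with s hs
    rw [show s - t = (1 - t / s) * s by field_simp, mul_pow]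
    ring
  have h4 : taylorSum g t n = fun s => (∑ k ∈ Finset.range n,
      (s - t) ^ (k + 1) / (k + 1).factorial * g (k + 1) s) + g 0 s := by
    ext s
    rw [taylorSum, Finset.sum_range_succ']
    simp
  rw [h4]
  simpa using (tendsto_finsetSum _ fun k _ => h1 k).add h.tendsto_atTop

theorem integrable_remainder (h : IsCMSequence g a b) {t : ℝ} (ht : 0 < t) (n : ℕ) :
    IntegrableOn (fun s => (s - t) ^ n / n.factorial * g (n + 1) s) (Ioi t) ∧
    ∫ s in Ioi t, (s - t) ^ n / n.factorial * g (n + 1) s = g 0 t - b := by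
  have hd : ∀ s ∈ Ici t, HasDerivAt (fun s => -taylorSum g t n s)
      ((s - t) ^ n / n.factorial * g (n + 1) s) s := fun s hs => by
    exact (h.hasDerivAt_taylorSum t n (lt_of_lt_of_le ht hs)).neg.congr_deriv (neg_neg _)
  have hp : ∀ s ∈ Ioi t, 0 ≤ (s - t) ^ n / n.factorial * g (n + 1) s := fun s hs => by
    have := h.nonneg (n + 1) s (lt_trans ht hs)
    have : 0 ≤ s - t := sub_nonneg.2 (le_of_lt hs)
    positivity
  have hl := (h.tendsto_taylorSum t n).neg
  refine ⟨integrableOn_Ioi_deriv_of_nonneg' hd hp hl, ?_⟩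
  rw [integral_Ioi_of_hasDerivAt_of_nonneg' hd hp hl]
  simp [taylorSum, Finset.sum_range_succ']
  ring

theorem integrable_cmDensity (h : IsCMSequence g a b) (n : ℕ) :
    IntegrableOn (cmDensity g n) (Ioi 0) ∧ ∫ s in Ioi 0, cmDensity g n s = a - b := by
  -- The value of `g 0` at `0` is arbitrary, so the primitive is redefined there by its right limit
  -- `-a`.
  set T : ℝ → ℝ := Function.update (fun s => -taylorSum g 0 n s) 0 (-a) with hT
  have hd : ∀ s ∈ Ioi (0 : ℝ), HasDerivAt T (cmDensity g n s) s := fun s hs => by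
    have h1 := (h.hasDerivAt_taylorSum 0 n hs).neg
    simp only [sub_zero, neg_neg] at h1
    refine h1.congr_of_eventuallyEq ?_
    filter_upwards [Ioi_mem_nhds hs] with x hx
    simp [hT, Function.update_of_ne (mem_Ioi.1 hx).ne']
  have hp : ∀ s ∈ Ioi (0 : ℝ), 0 ≤ cmDensity g n s := fun s hs => by
    have := h.nonneg (n + 1) s hs
    have : 0 ≤ s := le_of_lt hs
    unfold cmDensity
    positivity
  have hl : Tendsto T atTop (𝓝 (-b)) := by
    refine (h.tendsto_taylorSum 0 n).neg.congr' ?_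
    filter_upwards [Ioi_mem_atTop 0] with x hx
    simp [hT, Function.update_of_ne (mem_Ioi.1 hx).ne']
  have hc : ContinuousWithinAt T (Ici 0) 0 := by
    rw [hT, continuousWithinAt_update_same, Ici_sdiff_left]
    refine Tendsto.neg ?_
    have h4 : taylorSum g 0 n = fun s => (∑ k ∈ Finset.range n,
        ((k + 1).factorial : ℝ)⁻¹ * (s ^ (k + 1) * g (k + 1) s)) + g 0 s := by
      ext s
      rw [taylorSum, Finset.sum_range_succ']
      simp only [sub_zero, pow_zero, Nat.factorial_zero, Nat.cast_one, div_one, one_mul]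
      congr 1
      exact Finset.sum_congr rfl fun k _ => by ring
    rw [h4]
    have hl : Tendsto (fun s : ℝ => s / 2) (𝓝[>] 0) (𝓝[>] 0) := by
      refine tendsto_nhdsWithin_iff.2 ⟨?_, ?_⟩
      · have : Tendsto (fun s : ℝ => s / 2) (𝓝 0) (𝓝 (0 / 2)) := tendsto_id.div_const 2
        rw [zero_div] at this
        exact this.mono_left nhdsWithin_le_nhds
      · filter_upwards [self_mem_nhdsWithin] with s hs
        exact half_pos (mem_Ioi.1 hs)
    simpa using (tendsto_finsetSum (Finset.range n) fun k _ =>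
      (h.tendsto_pow_mul hl self_mem_nhdsWithin h.tendsto_zero k).const_mul
        ((k + 1).factorial : ℝ)⁻¹).add h.tendsto_zero
  refine ⟨integrableOn_Ioi_deriv_of_nonneg hc hd hp hl, ?_⟩
  rw [integral_Ioi_of_hasDerivAt_of_nonneg hc hd hp hl]
  simp [hT]
  ring

theorem cmDensity_nonneg (h : IsCMSequence g a b) (n : ℕ) {s : ℝ} (hs : 0 < s) :
    0 ≤ cmDensity g n s := by
  have := h.nonneg (n + 1) s hs
  unfold cmDensity
  positivity

end IsCMSequence

/-! ### Laplace transforms of truncated powers. -/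

/-- The Laplace–Carson transform at `p` of the truncated power `t ↦ (1 - t / s)₊ ^ m`. -/
noncomputable def truncatedPowTransform (m : ℕ) (p s : ℝ) : ℝ :=
  ∫ t in Ioi (0 : ℝ), Real.exp (-p * t) * max (1 - t / s) 0 ^ m

theorem max_one_sub_div_le_one {s t : ℝ} (hs : 0 < s) (ht : 0 < t) : max (1 - t / s) 0 ≤ 1 :=
  max_le (by have := div_pos ht hs; linarith) zero_le_one

theorem integrableOn_truncatedPow (m : ℕ) {p s : ℝ} (hp : 0 < p) (hs : 0 < s) :
    IntegrableOn (fun t => Real.exp (-p * t) * max (1 - t / s) 0 ^ m) (Ioi 0) := by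
  refine Integrable.mono' (exp_neg_integrableOn_Ioi 0 hp)
    (Continuous.aestronglyMeasurable (by fun_prop)) ?_
  refine (ae_restrict_iff' measurableSet_Ioi).2 (ae_of_all _ fun t ht => ?_)
  rw [norm_mul, norm_pow, Real.norm_of_nonneg (Real.exp_pos _).le,
    Real.norm_of_nonneg (le_max_right _ _)]
  exact mul_le_of_le_one_right (Real.exp_pos _).le
    (pow_le_one₀ (le_max_right _ _) (max_one_sub_div_le_one hs ht))

theorem truncatedPowTransform_le (m : ℕ) {p s : ℝ} (hp : 0 < p) (hs : 0 < s) :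
    truncatedPowTransform m p s ≤ 1 / (p + m / s) := by
  have hq : 0 < p + m / s := by positivity
  have h1 : ∫ t in Ioi (0 : ℝ), Real.exp (-(p + m / s) * t) = 1 / (p + m / s) := by
    rw [integral_exp_mul_Ioi (neg_lt_zero.2 hq), mul_zero, Real.exp_zero, neg_div_neg_eq]
  rw [← h1]
  refine setIntegral_mono_on (integrableOn_truncatedPow m hp hs) (exp_neg_integrableOn_Ioi 0 hq)
    measurableSet_Ioi fun t ht => ?_
  -- The upper bound compares the truncated power with `exp (-m t / s)`, whose transform is exact.
  have h2 : max (1 - t / s) 0 ^ m ≤ Real.exp (-(t / s)) ^ m :=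
    pow_le_pow_left₀ (le_max_right _ _)
      (max_le (Real.one_sub_le_exp_neg _) (Real.exp_pos _).le) m
  refine (mul_le_mul_of_nonneg_left h2 (Real.exp_pos _).le).trans_eq ?_
  rw [← Real.exp_nat_mul, ← Real.exp_add]
  congr 1
  field_simp
  ring

/-- The derivative of `-exp (-p t) (1 - t/s)^(m+1)` integrates to `1` over `[0, s]`, and it is at
most `p + (m+1)/s` times the integrand of the transform. -/
theorem le_truncatedPowTransform (m : ℕ) {p s : ℝ} (hp : 0 < p) (hs : 0 < s) :
    1 / (p + (m + 1) / s) ≤ truncatedPowTransform m p s := by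
  have hq : 0 < p + (m + 1) / s := by positivity
  have hd : ∀ t ∈ uIcc 0 s, HasDerivAt (fun t => -(Real.exp (-p * t) * (1 - t / s) ^ (m + 1)))
      (Real.exp (-p * t) * (1 - t / s) ^ m * (p * (1 - t / s) + (m + 1) / s)) t := by
    intro t _
    have h1 : HasDerivAt (fun t => Real.exp (-p * t)) (Real.exp (-p * t) * (-p * 1)) t :=
      ((hasDerivAt_id t).const_mul (-p)).exp
    have h2 : HasDerivAt (fun t => (1 - t / s) ^ (m + 1))
        (((m + 1 : ℕ) : ℝ) * (1 - t / s) ^ m * (-(1 / s))) t :=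
      (((hasDerivAt_id t).div_const s).const_sub 1).pow (m + 1)
    refine (h1.mul h2).neg.congr_deriv ?_
    push_cast
    ring
  have h1 := intervalIntegral.integral_eq_sub_of_hasDerivAt hd
    (Continuous.intervalIntegrable (by fun_prop) _ _)
  have h2 : ∫ t in (0 : ℝ)..s, Real.exp (-p * t) * (1 - t / s) ^ m * (p * (1 - t / s) + (m + 1) / s)
      = 1 := by
    rw [h1]
    simp [div_self hs.ne']
  have h3 : (1 : ℝ) ≤ ∫ t in (0 : ℝ)..s, (p + (m + 1) / s) *
      (Real.exp (-p * t) * max (1 - t / s) 0 ^ m) := by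
    refine h2.symm.trans_le ?_
    refine intervalIntegral.integral_mono_on hs.le (Continuous.intervalIntegrable (by fun_prop) _ _)
      (Continuous.intervalIntegrable (by fun_prop) _ _) fun t ht => ?_
    have h4 : 0 ≤ 1 - t / s := sub_nonneg.2 ((div_le_one hs).2 ht.2)
    have h5 : t / s ≥ 0 := div_nonneg ht.1 hs.le
    rw [max_eq_left h4, mul_comm]
    refine mul_le_mul_of_nonneg_right ?_ (by positivity)
    nlinarith
  rw [div_le_iff₀ hq, mul_comm]
  rw [intervalIntegral.integral_const_mul, intervalIntegral.integral_of_le hs.le] at h3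
  refine h3.trans (mul_le_mul_of_nonneg_left ?_ hq.le)
  refine setIntegral_mono_set (integrableOn_truncatedPow m hp hs) ?_
    (LE.le.eventuallyLE Ioc_subset_Ioi_self)
  exact ae_of_all _ fun t => mul_nonneg (Real.exp_pos _).le (pow_nonneg (le_max_right _ _) _)

theorem abs_truncatedPowTransform_sub_le {m : ℕ} (hm : m ≠ 0) {p s : ℝ} (hp : 0 < p) (hs : 0 < s) :
    |p * truncatedPowTransform m p s - p / (p + m / s)| ≤ 1 / m := by
  have hm' : (0 : ℝ) < m := by positivity
  have h1 := mul_le_mul_of_nonneg_left (truncatedPowTransform_le m hp hs) hp.le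
  have h2 := mul_le_mul_of_nonneg_left (le_truncatedPowTransform m hp hs) hp.le
  rw [mul_one_div] at h1 h2
  have h3 : p / (p + m / s) - p / (p + (m + 1) / s) ≤ 1 / m := by
    have e : p / (p + m / s) - p / (p + (m + 1) / s) =
        (p * s) / ((p * s + m) * (p * s + m + 1)) := by
      have : p * s + m ≠ 0 := by positivity
      have : p * s + m + 1 ≠ 0 := by positivity
      have : p * s + (m + 1) ≠ 0 := by positivity
      field_simp
      ring
    rw [e, div_le_div_iff₀ (by positivity) hm']
    nlinarith [mul_pos hp hs]
  rw [abs_le]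
  constructor
  · linarith
  · have : (0 : ℝ) < 1 / m := by positivity
    linarith

/-! ### Mixture representation and its Laplace transform. -/

namespace IsCMSequence
variable {g : ℕ → ℝ → ℝ} {a b : ℝ}

/-- A finite-order form of Bernstein's representation: for large `m` the kernel resembles `exp (-m t
/ s)`. -/
theorem sub_eq_integral (h : IsCMSequence g a b) {m : ℕ} (hm : m ≠ 0) {t : ℝ} (ht : 0 < t) :
    g 0 t - b = ∫ s in Ioi (0 : ℝ), max (1 - t / s) 0 ^ m * cmDensity g m s := by
  rw [← (h.integrable_remainder ht m).2]
  have h1 : ∫ s in Ioi t, (s - t) ^ m / m.factorial * g (m + 1) s =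
      ∫ s in Ioi t, max (1 - t / s) 0 ^ m * cmDensity g m s := by
    refine setIntegral_congr_fun measurableSet_Ioi fun s hs => ?_
    have hs0 : 0 < s := lt_trans ht hs
    have h4 : 0 ≤ 1 - t / s := sub_nonneg.2 ((div_le_one hs0).2 (le_of_lt hs))
    simp only [cmDensity, max_eq_left h4]
    rw [show s - t = (1 - t / s) * s by field_simp, mul_pow]
    ring
  rw [h1]
  symm
  refine setIntegral_eq_of_subset_of_forall_sdiff_eq_zero measurableSet_Ioi
    (Ioi_subset_Ioi ht.le) fun s hs => ?_
  have h2 : s ≤ t := not_lt.1 hs.2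
  -- Below `t` the truncated power vanishes only for a nonzero exponent, since `0 ^ 0 = 1`.
  rw [max_eq_right (sub_nonpos.2 ((one_le_div hs.1).2 h2)), zero_pow hm, zero_mul]

theorem integrable_uncurry_truncatedPow (h : IsCMSequence g a b) (m : ℕ) {p : ℝ} (hp : 0 < p) :
    Integrable (Function.uncurry fun t s : ℝ =>
      Real.exp (-p * t) * max (1 - t / s) 0 ^ m * cmDensity g m s)
      ((volume.restrict (Ioi (0 : ℝ))).prod (volume.restrict (Ioi 0))) := by
  have hI := (exp_neg_integrableOn_Ioi 0 hp).mul_prod (h.integrable_cmDensity m).1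
  have hmeas : AEStronglyMeasurable (fun z : ℝ × ℝ => max (1 - z.1 / z.2) 0 ^ m)
      ((volume.restrict (Ioi (0 : ℝ))).prod (volume.restrict (Ioi 0))) :=
    Measurable.aestronglyMeasurable (by fun_prop)
  refine Integrable.mono hI ?_ ?_
  · refine (hI.1.mul hmeas).congr (ae_of_all _ fun z => ?_)
    simp only [Function.uncurry, Pi.mul_apply]
    ring
  · rw [Measure.prod_restrict]
    refine (ae_restrict_iff' (measurableSet_Ioi.prod measurableSet_Ioi)).2
      (ae_of_all _ fun z hz => ?_)
    simp only [Function.uncurry, norm_mul, norm_pow]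
    rw [Real.norm_of_nonneg (le_max_right (1 - z.1 / z.2) 0)]
    refine mul_le_mul_of_nonneg_right ?_ (norm_nonneg _)
    exact mul_le_of_le_one_right (norm_nonneg _)
      (pow_le_one₀ (le_max_right _ _) (max_one_sub_div_le_one hz.2 hz.1))

theorem integral_exp_mul_sub (h : IsCMSequence g a b) {m : ℕ} (hm : m ≠ 0) {p : ℝ} (hp : 0 < p) :
    ∫ t in Ioi (0 : ℝ), Real.exp (-p * t) * (g 0 t - b) =
      ∫ s in Ioi (0 : ℝ), truncatedPowTransform m p s * cmDensity g m s := by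
  have h1 : ∫ t in Ioi (0 : ℝ), Real.exp (-p * t) * (g 0 t - b) =
      ∫ t in Ioi (0 : ℝ), ∫ s in Ioi (0 : ℝ),
        Real.exp (-p * t) * max (1 - t / s) 0 ^ m * cmDensity g m s := by
    refine setIntegral_congr_fun measurableSet_Ioi fun t ht => ?_
    simp only [h.sub_eq_integral hm ht, mul_assoc]
    rw [integral_const_mul]
  rw [h1, integral_integral_swap (h.integrable_uncurry_truncatedPow m hp)]
  refine setIntegral_congr_fun measurableSet_Ioi fun s _ => ?_
  simp only [truncatedPowTransform]
  rw [integral_mul_const]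

theorem integrableOn_truncatedPowTransform_mul (h : IsCMSequence g a b) (m : ℕ) {p : ℝ}
    (hp : 0 < p) :
    IntegrableOn (fun s => truncatedPowTransform m p s * cmDensity g m s) (Ioi 0) := by
  refine (h.integrable_uncurry_truncatedPow m hp).integral_prod_right.congr
    (ae_of_all _ fun s => ?_)
  simp only [truncatedPowTransform, Function.uncurry]
  rw [integral_mul_const]

theorem integrableOn_mul_cmDensity (h : IsCMSequence g a b) (m : ℕ) {φ : ℝ → ℂ} {C : ℝ}
    (hφ : ContinuousOn φ (Ioi 0)) (hC : ∀ s, 0 < s → ‖φ s‖ ≤ C) :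
    IntegrableOn (fun s => φ s * (cmDensity g m s : ℂ)) (Ioi 0) := by
  have h1 : IntegrableOn (fun s => (cmDensity g m s : ℂ)) (Ioi 0) :=
    (h.integrable_cmDensity m).1.ofReal
  refine Integrable.bdd_mul (c := C) h1 (hφ.aestronglyMeasurable measurableSet_Ioi) ?_
  exact (ae_restrict_iff' measurableSet_Ioi).2 (ae_of_all _ hC)

theorem norm_integral_mul_cmDensity_le (h : IsCMSequence g a b) (m : ℕ) {φ : ℝ → ℂ} {C : ℝ}
    (hC : ∀ s, 0 < s → ‖φ s‖ ≤ C) :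
    ‖∫ s in Ioi (0 : ℝ), φ s * (cmDensity g m s : ℂ)‖ ≤ C * (a - b) := by
  rw [← (h.integrable_cmDensity m).2, ← integral_const_mul]
  refine norm_integral_le_of_norm_le ((h.integrable_cmDensity m).1.const_mul C) ?_
  refine (ae_restrict_iff' measurableSet_Ioi).2 (ae_of_all _ fun s hs => ?_)
  rw [norm_mul, Complex.norm_real, Real.norm_of_nonneg (h.cmDensity_nonneg m hs)]
  exact mul_le_mul_of_nonneg_right (hC s hs) (h.cmDensity_nonneg m hs)

theorem re_mul_integral_mul_cmDensity_nonneg (h : IsCMSequence g a b) (m : ℕ) {φ : ℝ → ℂ} {C : ℝ}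
    (hφ : ContinuousOn φ (Ioi 0)) (hC : ∀ s, 0 < s → ‖φ s‖ ≤ C) (c : ℂ)
    (hc : ∀ s, 0 < s → 0 ≤ (c * φ s).re) :
    0 ≤ (c * ∫ s in Ioi (0 : ℝ), φ s * (cmDensity g m s : ℂ)).re := by
  rw [← integral_const_mul, ← RCLike.re_eq_complex_re,
    ← integral_re ((h.integrableOn_mul_cmDensity m hφ hC).const_mul c)]
  refine setIntegral_nonneg measurableSet_Ioi fun s hs => ?_
  rw [← mul_assoc, RCLike.re_eq_complex_re, Complex.re_mul_ofReal]
  exact mul_nonneg (hc s hs) (h.cmDensity_nonneg m hs)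

/-- Fubini turns the transform into an integral against the density; the kernels differ by at most
`1/m` and the density has mass `a - b`. -/
theorem norm_integral_sub_le (h : IsCMSequence g a b) {m : ℕ} (hm : m ≠ 0) {p : ℝ} (hp : 0 < p) :
    ‖(∫ s in Ioi (0 : ℝ), (p : ℂ) / (p + (m / s : ℝ)) * (cmDensity g m s : ℂ)) -
      (p * ∫ t in Ioi (0 : ℝ), Real.exp (-p * t) * (g 0 t - b) : ℝ)‖ ≤ 1 / m * (a - b) := by
  have h2 : ∀ s : ℝ, 0 < s → ‖(p : ℂ) / (p + (m / s : ℝ)) - (p * truncatedPowTransform m p s : ℝ)‖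
      ≤ 1 / m := by
    intro s hs
    rw [norm_sub_rev]
    have := abs_truncatedPowTransform_sub_le hm hp hs
    rw [← Real.norm_eq_abs, ← Complex.norm_real] at this
    exact_mod_cast this
  have h1 := h.norm_integral_mul_cmDensity_le m h2
  convert h1 using 2
  simp only [sub_mul]
  have hc : ContinuousOn (fun s : ℝ => (p : ℂ) / (p + (m / s : ℝ))) (Ioi 0) := by
    intro s hs
    have h0 : (p : ℂ) + (m / s : ℝ) ≠ 0 := by
      have : 0 < p + m / s := by
        have := mem_Ioi.1 hs
        positivity
      exact_mod_cast this.ne'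
    have : s ≠ 0 := (mem_Ioi.1 hs).ne'
    refine ContinuousAt.continuousWithinAt ?_
    refine ContinuousAt.div continuousAt_const (continuousAt_const.add ?_) h0
    exact Complex.continuous_ofReal.continuousAt.comp (continuousAt_const.div continuousAt_id this)
  have hb : ∀ s : ℝ, 0 < s → ‖(p : ℂ) / (p + (m / s : ℝ))‖ ≤ 1 := by
    intro s hs
    have : (p : ℂ) / (p + (m / s : ℝ)) = (p / (p + m / s) : ℝ) := by push_cast; rfl
    rw [this, Complex.norm_real, Real.norm_of_nonneg (by positivity), div_le_one (by positivity)]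
    have : 0 ≤ m / s := by positivity
    linarith
  have hI1 := h.integrableOn_mul_cmDensity m hc hb
  have hI2 : IntegrableOn (fun s => ((p * truncatedPowTransform m p s : ℝ) : ℂ) *
      (cmDensity g m s : ℂ)) (Ioi 0) := by
    refine ((h.integrableOn_truncatedPowTransform_mul m hp).const_mul p).ofReal.congr
      (ae_of_all _ fun s => ?_)
    simp [mul_assoc]
  rw [integral_sub hI1 hI2]
  congr 1
  rw [h.integral_exp_mul_sub hm hp, ← integral_const_mul, ← integral_complex_ofReal]
  congr 1
  ext s
  push_cast
  ring

end IsCMSequence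

/-! ### The kernel `z / (z + r)` on the slit plane. -/

/-- The principal square root on the slit plane. -/
noncomputable def slitSqrt (z : ℂ) : ℂ := z ^ (1 / 2 : ℂ)

theorem slitSqrt_mul_self {z : ℂ} (hz : z ∈ Complex.slitPlane) : slitSqrt z * slitSqrt z = z := by
  rw [slitSqrt, ← Complex.cpow_add _ _ (Complex.slitPlane_ne_zero hz)]
  norm_num

theorem slitSqrt_re_pos {z : ℂ} (hz : z ∈ Complex.slitPlane) : 0 < (slitSqrt z).re := by
  have h0 := Complex.slitPlane_ne_zero hz
  have h1 : (Complex.log z * (1 / 2)).im = z.arg / 2 := by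
    rw [show (1 / 2 : ℂ) = ((1 / 2 : ℝ) : ℂ) by push_cast; rfl, Complex.im_mul_ofReal,
      Complex.log_im]
    ring
  rw [slitSqrt, Complex.cpow_def_of_ne_zero h0, Complex.exp_re, h1]
  refine mul_pos (Real.exp_pos _) (Real.cos_pos_of_mem_Ioo ⟨?_, ?_⟩)
  · linarith [Complex.neg_pi_lt_arg z]
  · have h2 := (Complex.arg_le_pi z).lt_of_ne (Complex.mem_slitPlane_iff_arg.1 hz).1
    linarith

theorem slitSqrt_ne_zero {z : ℂ} (hz : z ∈ Complex.slitPlane) : slitSqrt z ≠ 0 := by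
  intro h
  have := slitSqrt_re_pos hz
  simp [h] at this

theorem slitSqrt_ofReal {p : ℝ} (hp : 0 < p) : slitSqrt p = (Real.sqrt p : ℝ) := by
  rw [slitSqrt, Real.sqrt_eq_rpow, Complex.ofReal_cpow hp.le]
  norm_num

theorem continuousOn_slitSqrt : ContinuousOn slitSqrt Complex.slitPlane := fun _ hz =>
  (continuousAt_id.cpow continuousAt_const hz).continuousWithinAt

/-- The aperture bound `1 / cos (arg z / 2)`. -/
noncomputable def aperture (z : ℂ) : ℝ := ‖slitSqrt z‖ / (slitSqrt z).re

theorem aperture_nonneg {z : ℂ} (hz : z ∈ Complex.slitPlane) : 0 ≤ aperture z :=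
  div_nonneg (norm_nonneg _) (slitSqrt_re_pos hz).le

theorem continuousAt_aperture {z : ℂ} (hz : z ∈ Complex.slitPlane) : ContinuousAt aperture z := by
  have h := (continuousOn_slitSqrt z hz).continuousAt (Complex.isOpen_slitPlane.mem_nhds hz)
  exact h.norm.div (Complex.continuous_re.continuousAt.comp h) (slitSqrt_re_pos hz).ne'

section Kernel
variable {z w : ℂ} {r : ℝ}

theorem add_ofReal_ne_zero (hz : z ∈ Complex.slitPlane) (hr : 0 ≤ r) : z + r ≠ 0 := by
  intro h
  rw [eq_neg_of_add_eq_zero_left h, Complex.mem_slitPlane_iff] at hz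
  simp at hz
  linarith

/-- In this symmetric form the denominator has real part at least that of `slitSqrt z`. This yields
both the bound by `aperture z` and the rotated positivity, uniformly in `r`. -/
theorem div_add_eq_slitSqrt (hz : z ∈ Complex.slitPlane) :
    z / (z + r) = slitSqrt z / (slitSqrt z + r / slitSqrt z) := by
  have h := slitSqrt_ne_zero hz
  conv_lhs => rw [← slitSqrt_mul_self hz]
  rw [← mul_div_mul_left (slitSqrt z) _ h, mul_add, mul_div_cancel₀ _ h]

theorem re_slitSqrt_le (hz : z ∈ Complex.slitPlane) (hr : 0 ≤ r) :
    (slitSqrt z).re ≤ (slitSqrt z + r / slitSqrt z).re := by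
  rw [Complex.add_re, Complex.div_re]
  have := slitSqrt_re_pos hz
  have h2 := Complex.normSq_nonneg (slitSqrt z)
  simp
  positivity

theorem norm_div_add_le (hz : z ∈ Complex.slitPlane) (hr : 0 ≤ r) :
    ‖z / (z + r)‖ ≤ aperture z := by
  rw [div_add_eq_slitSqrt hz, norm_div, aperture]
  exact div_le_div_of_nonneg_left (norm_nonneg _) (slitSqrt_re_pos hz)
    ((re_slitSqrt_le hz hr).trans (Complex.re_le_norm _))

theorem re_conj_slitSqrt_mul_nonneg (hz : z ∈ Complex.slitPlane) (hr : 0 ≤ r) :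
    0 ≤ (conj (slitSqrt z) * (z / (z + r))).re := by
  rw [div_add_eq_slitSqrt hz, ← mul_div_assoc, mul_comm, Complex.mul_conj, Complex.div_re]
  have := (slitSqrt_re_pos hz).trans_le (re_slitSqrt_le hz hr)
  have h2 := Complex.normSq_nonneg (slitSqrt z)
  have h3 := Complex.normSq_nonneg (slitSqrt z + r / slitSqrt z)
  rw [Complex.ofReal_re, Complex.ofReal_im]
  simp only [zero_mul, zero_div, add_zero]
  positivity

theorem re_conj_mul_nonneg :
    0 ≤ ((z.im : ℂ) * Complex.I * conj z * (z / (z + r))).re := by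
  rw [← mul_div_assoc, mul_assoc _ (conj z), mul_comm (conj z), Complex.mul_conj, Complex.div_re]
  have h2 := Complex.normSq_nonneg z
  have h3 := Complex.normSq_nonneg (z + r)
  simp
  refine div_nonneg ?_ h3
  nlinarith [mul_nonneg h2 (mul_self_nonneg z.im)]

/-- Exact second-order remainder at `w`. Derivative and remainder are expressed through the kernel
itself, so its bound controls them uniformly in `r`. -/
theorem div_add_sub_div_add (hz : z ∈ Complex.slitPlane) (hw : w ∈ Complex.slitPlane)
    (hr : 0 ≤ r) :
    z / (z + r) - w / (w + r) - (z - w) * ((1 - w / (w + r)) * (w / (w + r)) / w) =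
      -((z - w) ^ 2 * ((1 - z / (z + r)) * (w / (w + r)) ^ 2 / w ^ 2)) := by
  have h1 := add_ofReal_ne_zero hz hr
  have h2 := add_ofReal_ne_zero hw hr
  have h3 := Complex.slitPlane_ne_zero hw
  field_simp
  ring

theorem norm_derivKernel_le (hw : w ∈ Complex.slitPlane) (hr : 0 ≤ r) :
    ‖(1 - w / (w + r)) * (w / (w + r)) / w‖ ≤ (1 + aperture w) * aperture w / ‖w‖ := by
  rw [norm_div, norm_mul]
  have h1 := norm_div_add_le hw hr
  have h2 : ‖1 - w / (w + r)‖ ≤ 1 + aperture w :=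
    (norm_sub_le _ _).trans (by simpa using h1)
  have := aperture_nonneg hw
  gcongr

theorem norm_remainderKernel_le (hz : z ∈ Complex.slitPlane) (hw : w ∈ Complex.slitPlane)
    (hr : 0 ≤ r) :
    ‖z / (z + r) - w / (w + r) - (z - w) * ((1 - w / (w + r)) * (w / (w + r)) / w)‖ ≤
      ‖z - w‖ ^ 2 * ((1 + aperture z) * aperture w ^ 2 / ‖w‖ ^ 2) := by
  rw [div_add_sub_div_add hz hw hr, norm_neg, norm_mul, norm_div, norm_mul, norm_pow, norm_pow,
    norm_pow]
  have h1 := norm_div_add_le hw hr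
  have h2 : ‖1 - z / (z + r)‖ ≤ 1 + aperture z :=
    (norm_sub_le _ _).trans (by simpa using norm_div_add_le hz hr)
  have := aperture_nonneg hz
  gcongr

theorem continuousOn_div_add (hz : z ∈ Complex.slitPlane) (m : ℕ) :
    ContinuousOn (fun s : ℝ => z / (z + (m / s : ℝ))) (Ioi 0) := by
  intro s hs
  have hs' : 0 < s := hs
  refine ContinuousAt.continuousWithinAt ?_
  refine ContinuousAt.div continuousAt_const (continuousAt_const.add ?_)
    (add_ofReal_ne_zero hz (by positivity))
  exact Complex.continuous_ofReal.continuousAt.comp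
    (continuousAt_const.div continuousAt_id hs'.ne')

end Kernel

/-! ### Limit of the approximants and analytic continuation. -/

theorem Ultrafilter.exists_tendsto_of_norm_le (U : Ultrafilter ℕ) {x : ℕ → ℂ} {C : ℝ}
    (hx : ∀ m, ‖x m‖ ≤ C) : ∃ y, Tendsto x U (𝓝 y) := by
  obtain ⟨y, -, hy⟩ := (isCompact_closedBall (0 : ℂ) C).ultrafilter_le_nhds (U.map x) (by
    rw [le_principal_iff]
    exact mem_map.2 (univ_mem' fun m => by simpa using hx m))
  exact ⟨y, hy⟩

/-- A quadratic error bound survives pointwise limits, so holomorphy of the limit follows without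
locally uniform convergence. -/
theorem hasDerivAt_of_norm_sub_le_sq {f : ℂ → ℂ} {w D : ℂ} {K : ℝ}
    (h : ∀ᶠ z in 𝓝 w, ‖f z - f w - (z - w) * D‖ ≤ K * ‖z - w‖ ^ 2) : HasDerivAt f D w := by
  rw [hasDerivAt_iff_isLittleO]
  refine Asymptotics.IsBigO.trans_isLittleO (g := fun z => ‖z - w‖ ^ 2) ?_
    (Asymptotics.isLittleO_pow_sub_sub w one_lt_two)
  refine Asymptotics.IsBigO.of_bound K ?_
  filter_upwards [h] with z hz
  simpa using hz

namespace IsCMSequence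
variable {g : ℕ → ℝ → ℝ} {a b : ℝ}

/-- The Stieltjes-type approximants `∫ z / (z + m / s) dμ_m(s)` with `m` shifted by one. -/
noncomputable def _root_.stieltjesApprox (g : ℕ → ℝ → ℝ) (m : ℕ) (z : ℂ) : ℂ :=
  ∫ s in Ioi (0 : ℝ), z / (z + ((m + 1 : ℕ) / s : ℝ)) * (cmDensity g (m + 1) s : ℂ)

noncomputable def _root_.stieltjesApproxDeriv (g : ℕ → ℝ → ℝ) (m : ℕ) (z : ℂ) : ℂ :=
  ∫ s in Ioi (0 : ℝ), (1 - z / (z + ((m + 1 : ℕ) / s : ℝ))) * (z / (z + ((m + 1 : ℕ) / s : ℝ))) / z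
    * (cmDensity g (m + 1) s : ℂ)

theorem norm_stieltjesApprox_le (h : IsCMSequence g a b) (m : ℕ) {z : ℂ}
    (hz : z ∈ Complex.slitPlane) : ‖stieltjesApprox g m z‖ ≤ aperture z * (a - b) :=
  h.norm_integral_mul_cmDensity_le (m + 1) fun s hs => norm_div_add_le hz (by positivity)

theorem norm_stieltjesApproxDeriv_le (h : IsCMSequence g a b) (m : ℕ) {z : ℂ}
    (hz : z ∈ Complex.slitPlane) :
    ‖stieltjesApproxDeriv g m z‖ ≤ (1 + aperture z) * aperture z / ‖z‖ * (a - b) :=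
  h.norm_integral_mul_cmDensity_le (m + 1) fun s hs => norm_derivKernel_le hz (by positivity)

theorem norm_stieltjesApprox_sub_le (h : IsCMSequence g a b) (m : ℕ) {z w : ℂ}
    (hz : z ∈ Complex.slitPlane) (hw : w ∈ Complex.slitPlane) :
    ‖stieltjesApprox g m z - stieltjesApprox g m w - (z - w) * stieltjesApproxDeriv g m w‖ ≤
      ‖z - w‖ ^ 2 * ((1 + aperture z) * aperture w ^ 2 / ‖w‖ ^ 2) * (a - b) := by
  have h1 := h.norm_integral_mul_cmDensity_le (m + 1)
    (φ := fun s => z / (z + ((m + 1 : ℕ) / s : ℝ)) - w / (w + ((m + 1 : ℕ) / s : ℝ)) -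
      (z - w) * ((1 - w / (w + ((m + 1 : ℕ) / s : ℝ))) * (w / (w + ((m + 1 : ℕ) / s : ℝ))) / w))
    fun s hs => norm_remainderKernel_le hz hw (by positivity)
  have cz := continuousOn_div_add hz (m + 1)
  have cw := continuousOn_div_add hw (m + 1)
  have i1 := h.integrableOn_mul_cmDensity (m + 1) cz fun s hs =>
    norm_div_add_le hz (by positivity)
  have i2 := h.integrableOn_mul_cmDensity (m + 1) cw fun s hs =>
    norm_div_add_le hw (by positivity)
  have i3 := h.integrableOn_mul_cmDensity (m + 1)
    (((continuousOn_const (c := (1 : ℂ))).sub cw).mul cw |>.div_const w) fun s hs =>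
    norm_derivKernel_le hw (by positivity)
  convert h1 using 2
  rw [stieltjesApprox, stieltjesApprox, stieltjesApproxDeriv, ← integral_const_mul,
    ← integral_sub i1 i2]
  refine (integral_sub (i1.sub i2) (i3.const_mul (z - w))).symm.trans ?_
  refine integral_congr_ae (ae_of_all _ fun s => ?_)
  simp only [Pi.sub_apply, Pi.mul_apply]
  ring

theorem tendsto_stieltjesApprox (h : IsCMSequence g a b) {p : ℝ} (hp : 0 < p) :
    Tendsto (fun m => stieltjesApprox g m p) atTop
      (𝓝 (p * ∫ t in Ioi (0 : ℝ), Real.exp (-p * t) * (g 0 t - b) : ℝ)) := by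
  rw [tendsto_iff_norm_sub_tendsto_zero]
  have h1 : Tendsto (fun m : ℕ => 1 / ((m + 1 : ℕ) : ℝ) * (a - b)) atTop (𝓝 (0 * (a - b))) := by
    refine Tendsto.mul_const _ ?_
    exact_mod_cast tendsto_one_div_add_atTop_nhds_zero_nat (𝕜 := ℝ)
  rw [zero_mul] at h1
  exact squeeze_zero (fun _ => norm_nonneg _)
    (fun m => h.norm_integral_sub_le (Nat.succ_ne_zero m) hp) h1

theorem integrableOn_exp_mul (h : IsCMSequence g a b) {p : ℝ} (hp : 0 < p) :
    IntegrableOn (fun t => Real.exp (-p * t) * g 0 t) (Ioi 0) := by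
  refine Integrable.mul_bdd (c := a) (exp_neg_integrableOn_Ioi 0 hp)
    ((h.continuousOn 0).aestronglyMeasurable measurableSet_Ioi) ?_
  refine (ae_restrict_iff' measurableSet_Ioi).2 (ae_of_all _ fun t ht => ?_)
  rw [Real.norm_of_nonneg (h.nonneg 0 t ht)]
  exact h.le_left ht

theorem exists_continuation (h : IsCMSequence g a b) (hb : 0 ≤ b) :
    ∃ Q : ℂ → ℂ, DifferentiableOn ℂ Q Complex.slitPlane ∧
      (∀ p : ℝ, 0 < p → Q p = (p * ∫ t in Ioi (0 : ℝ), Real.exp (-p * t) * g 0 t : ℝ)) ∧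
      (∀ z ∈ Complex.slitPlane, (slitSqrt z).re * b ≤ (conj (slitSqrt z) * Q z).re) ∧
      ∀ z ∈ Complex.slitPlane, 0 ≤ ((z.im : ℂ) * Complex.I * conj z * Q z).re := by
  set U : Ultrafilter ℕ := Filter.hyperfilter ℕ
  -- Since the ultrafilter is nonprincipal, its limits agree with the ordinary limit known at
  -- positive `p`.
  have hU : (U : Filter ℕ) ≤ atTop := by
    rw [← Nat.cofinite_eq_atTop]
    exact Filter.hyperfilter_le_cofinite
  have h1 : ∀ z : Complex.slitPlane, ∃ y, Tendsto (fun m => stieltjesApprox g m z) U (𝓝 y) :=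
    fun z => U.exists_tendsto_of_norm_le fun m => h.norm_stieltjesApprox_le m z.2
  have h2 : ∀ z : Complex.slitPlane, ∃ y, Tendsto (fun m => stieltjesApproxDeriv g m z) U (𝓝 y) :=
    fun z => U.exists_tendsto_of_norm_le fun m => h.norm_stieltjesApproxDeriv_le m z.2
  choose q hq using h1
  choose D hD using h2
  classical
  set q' : ℂ → ℂ := fun z => if hz : z ∈ Complex.slitPlane then q ⟨z, hz⟩ else 0 with hq'
  have hlim : ∀ z ∈ Complex.slitPlane, Tendsto (fun m => stieltjesApprox g m z) U (𝓝 (q' z)) := by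
    intro z hz
    simpa [hq', hz] using hq ⟨z, hz⟩
  refine ⟨fun z => b + q' z, ?_, ?_, ?_, ?_⟩
  · refine DifferentiableOn.const_add _ fun w hw => ?_
    refine DifferentiableAt.differentiableWithinAt ?_
    have hd : HasDerivAt q' (D ⟨w, hw⟩) w := by
      -- By continuity, `aperture z < aperture w + 1` near `w`, which makes the constant independent
      -- of `z`.
      refine hasDerivAt_of_norm_sub_le_sq
        (K := (1 + (aperture w + 1)) * aperture w ^ 2 / ‖w‖ ^ 2 * (a - b)) ?_
      filter_upwards [Complex.isOpen_slitPlane.mem_nhds hw,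
        (continuousAt_aperture hw).eventually_lt continuousAt_const (lt_add_one _)] with z hz hzw
      refine le_of_tendsto (((hlim z hz).sub (hlim w hw)).sub
        ((hD ⟨w, hw⟩).const_mul (z - w))).norm (univ_mem' fun m => ?_)
      refine (h.norm_stieltjesApprox_sub_le m hz hw).trans ?_
      have hab : 0 ≤ a - b := sub_nonneg.2 ((h.right_le one_pos).trans (h.le_left one_pos))
      rw [mul_assoc, mul_comm]
      gcongr
    exact hd.differentiableAt
  · intro p hp
    have hpz : (p : ℂ) ∈ Complex.slitPlane := by simpa using hp
    have h3 := tendsto_nhds_unique (hlim p hpz) ((h.tendsto_stieltjesApprox hp).mono_left hU)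
    simp only [h3]
    norm_cast
    have i1 : IntegrableOn (fun t => Real.exp (-p * t)) (Ioi 0) := exp_neg_integrableOn_Ioi 0 hp
    have i2 := h.integrableOn_exp_mul hp
    simp only [mul_sub]
    rw [integral_sub i2 (i1.mul_const b), integral_mul_const,
      integral_exp_mul_Ioi (neg_lt_zero.2 hp)]
    simp only [mul_zero, Real.exp_zero]
    field_simp
    ring
  · intro z hz
    have h4 : 0 ≤ (conj (slitSqrt z) * q' z).re := by
      refine ge_of_tendsto (Complex.continuous_re.continuousAt.tendsto.comp
        ((hlim z hz).const_mul (conj (slitSqrt z)))) (univ_mem' fun m => ?_)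
      exact h.re_mul_integral_mul_cmDensity_nonneg (m + 1) (continuousOn_div_add hz (m + 1))
        (fun s hs => norm_div_add_le hz (by positivity)) _
        (fun s hs => re_conj_slitSqrt_mul_nonneg hz (by positivity))
    rw [mul_add, Complex.add_re, Complex.re_mul_ofReal, Complex.conj_re]
    linarith
  · intro z hz
    have h4 : 0 ≤ ((z.im : ℂ) * Complex.I * conj z * q' z).re := by
      refine ge_of_tendsto (Complex.continuous_re.continuousAt.tendsto.comp
        ((hlim z hz).const_mul ((z.im : ℂ) * Complex.I * conj z))) (univ_mem' fun m => ?_)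
      exact h.re_mul_integral_mul_cmDensity_nonneg (m + 1) (continuousOn_div_add hz (m + 1))
        (fun s hs => norm_div_add_le hz (by positivity)) _
        (fun _ _ => re_conj_mul_nonneg)
    rw [mul_add, Complex.add_re, Complex.re_mul_ofReal]
    refine add_nonneg (mul_nonneg ?_ hb) h4
    simp
    exact mul_self_nonneg _

end IsCMSequence

/-! ### Principal square roots and the resolvent integral. -/

section PrincipalSqrt
variable {d : ℕ} {B Y Z : Matrix (Fin d) (Fin d) ℂ}

/-- Sylvester's argument: `Y - Z` intertwines `Y` and `-Z`, whose spectra lie in opposite open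
half-planes. The characteristic polynomial of `Y` kills `Y` but is invertible at `-Z`, forcing `Y -
Z = 0`. -/
theorem IsPrincipalSqrt.unique (hY : IsPrincipalSqrt B Y) (hZ : IsPrincipalSqrt B Z) : Y = Z := by
  have h1 : Y * (Y - Z) = (Y - Z) * (-Z) := by
    have h0 : Y * Y = Z * Z := hY.1.trans hZ.1.symm
    rw [mul_sub, sub_mul, mul_neg, mul_neg, h0]
    abel
  have h2 : ∀ q : Polynomial ℂ, Polynomial.aeval Y q * (Y - Z) =
      (Y - Z) * Polynomial.aeval (-Z) q := by
    intro q
    induction q using Polynomial.induction_on' with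
    | add p q hp hq => rw [map_add, map_add, add_mul, mul_add, hp, hq]
    | monomial n c =>
      have h3 : ∀ n : ℕ, Y ^ n * (Y - Z) = (Y - Z) * (-Z) ^ n := by
        intro n
        induction n with
        | zero => simp
        | succ n ih => rw [pow_succ, mul_assoc, h1, ← mul_assoc, ih, mul_assoc, ← pow_succ]
      rw [Polynomial.aeval_monomial, Polynomial.aeval_monomial, mul_assoc, h3,
        ← mul_assoc, Algebra.commutes, mul_assoc]
  have h3 := h2 Y.charpoly
  rw [Matrix.aeval_self_charpoly, zero_mul] at h3
  have h4 : IsUnit (Polynomial.aeval (-Z) Y.charpoly) := by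
    rw [← spectrum.zero_notMem_iff ℂ]
    intro h0
    rcases isEmpty_or_nonempty (Fin d) with he | hne
    · exact absurd h0 (by simp)
    rw [spectrum.map_polynomial_aeval_of_nonempty (-Z) Y.charpoly
      (spectrum.nonempty_of_isAlgClosed_of_finiteDimensional ℂ (-Z))] at h0
    obtain ⟨μ, hμ, hμ0⟩ := h0
    have h5 : μ ∈ spectrum ℂ Y := by
      rw [Matrix.mem_spectrum_iff_isRoot_charpoly]
      exact hμ0
    rw [← spectrum.neg_eq, Set.mem_neg] at hμ
    have h6 := hZ.2 _ hμ
    have h7 := hY.2 _ h5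
    rw [Complex.neg_re] at h6
    linarith
  exact sub_eq_zero.1 ((h4.mul_left_eq_zero).1 h3.symm)

theorem IsPrincipalSqrt.principalSqrt_eq (hY : IsPrincipalSqrt B Y) : principalSqrt B = Y := by
  have h : ∃ Y, IsPrincipalSqrt B Y := ⟨Y, hY⟩
  rw [principalSqrt, dif_pos h]
  exact h.choose_spec.unique hY

end PrincipalSqrt

theorem integrable_inv_sq_add_sq {s : ℝ} (hs : 0 < s) :
    Integrable fun u : ℝ => (u ^ 2 + s ^ 2)⁻¹ := by
  have h := (integrable_inv_one_add_sq.comp_div hs.ne').const_mul (s ^ 2)⁻¹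
  refine h.congr (ae_of_all _ fun u => ?_)
  simp only
  rw [← mul_inv]
  congr 1
  field_simp
  ring

theorem integral_univ_inv_sq_add_sq {s : ℝ} (hs : 0 < s) :
    ∫ u : ℝ, (u ^ 2 + s ^ 2)⁻¹ = Real.pi * s⁻¹ := by
  have h := Measure.integral_comp_div (fun u : ℝ => (1 + u ^ 2)⁻¹) s
  have h2 : (fun u : ℝ => (u ^ 2 + s ^ 2)⁻¹) = fun u => (s ^ 2)⁻¹ * (1 + (u / s) ^ 2)⁻¹ := by
    ext u
    rw [← mul_inv]
    congr 1
    field_simp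
    ring
  rw [h2, integral_const_mul, h, integral_univ_inv_one_add_sq, abs_of_pos hs, smul_eq_mul]
  field_simp

section Spectral
open Matrix
variable {d : ℕ} (U : Matrix (Fin d) (Fin d) ℂ)

/-- The matrix with eigenvalues `h i` and eigenvectors the columns of the unitary `U`. -/
def diagConj (h : Fin d → ℂ) : Matrix (Fin d) (Fin d) ℂ := U * diagonal h * Uᴴ

theorem diagConj_apply (h : Fin d → ℂ) (i j : Fin d) :
    diagConj U h i j = ∑ k, h k * (U i k * star (U j k)) := by
  rw [diagConj, mul_apply]
  refine Finset.sum_congr rfl fun k _ => ?_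
  rw [mul_diagonal, conjTranspose_apply]
  ring

variable {U}

theorem diagConj_mul (hU : Uᴴ * U = 1) (h k : Fin d → ℂ) :
    diagConj U h * diagConj U k = diagConj U (h * k) := by
  calc diagConj U h * diagConj U k = U * diagonal h * (Uᴴ * U) * diagonal k * Uᴴ := by
        simp only [diagConj, mul_assoc]
    _ = diagConj U (h * k) := by
        rw [hU, mul_one, mul_assoc U, diagonal_mul_diagonal, diagConj]
        rfl

theorem diagConj_const (hU : U * Uᴴ = 1) (c : ℂ) :
    diagConj U (fun _ => c) = c • (1 : Matrix (Fin d) (Fin d) ℂ) := by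
  rw [diagConj, ← smul_one_eq_diagonal, Matrix.mul_smul, mul_one, Matrix.smul_mul, hU]

theorem diagConj_add (h k : Fin d → ℂ) :
    diagConj U (h + k) = diagConj U h + diagConj U k := by
  rw [diagConj, diagConj, diagConj, ← add_mul, ← mul_add, diagonal_add]
  rfl

theorem diagConj_inv (hU : Uᴴ * U = 1) {h : Fin d → ℂ} (hh : ∀ i, h i ≠ 0) :
    (diagConj U h)⁻¹ = diagConj U h⁻¹ := by
  refine inv_eq_right_inv ?_
  rw [diagConj_mul hU]
  have : h * h⁻¹ = fun _ => (1 : ℂ) := by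
    ext i
    exact mul_inv_cancel₀ (hh i)
  rw [this, diagConj_const (mul_eq_one_comm.1 hU), one_smul]

/-- A positive definite matrix has a principal square root `Y`, and
`∫ (u ^ 2 + B)⁻¹ du = π Y⁻¹`. -/
theorem Matrix.PosDef.exists_isPrincipalSqrt {B : Matrix (Fin d) (Fin d) ℂ} (hB : B.PosDef) :
    ∃ Y, IsPrincipalSqrt B Y ∧ ∀ i j,
      ∫ u : ℝ, (((u : ℂ) ^ 2) • (1 : Matrix (Fin d) (Fin d) ℂ) + B)⁻¹ i j =
        Real.pi * Y⁻¹ i j := by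
  set lam := hB.isHermitian.eigenvalues with hlam
  have hpos : ∀ i, 0 < lam i := hB.eigenvalues_pos
  set U : Matrix (Fin d) (Fin d) ℂ := (hB.isHermitian.eigenvectorUnitary).1
  have hU : Uᴴ * U = 1 := Unitary.coe_star_mul_self hB.isHermitian.eigenvectorUnitary
  have hU' : U * Uᴴ = 1 := mul_eq_one_comm.1 hU
  have hBU : B = diagConj U (fun i => (lam i : ℂ)) := by
    conv_lhs => rw [hB.isHermitian.spectral_theorem]
    rfl
  set r : Fin d → ℝ := fun i => Real.sqrt (lam i) with hr
  have hr0 : ∀ i, 0 < r i := fun i => Real.sqrt_pos.2 (hpos i)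
  have hr2 : ∀ i, r i ^ 2 = lam i := fun i => Real.sq_sqrt (hpos i).le
  refine ⟨diagConj U (fun i => (r i : ℂ)), ⟨?_, ?_⟩, fun i j => ?_⟩
  · rw [diagConj_mul hU, hBU]
    congr 1
    ext i
    simp only [Pi.mul_apply]
    rw [← hr2 i]
    push_cast
    ring
  · intro μ hμ
    by_contra hre
    refine spectrum.mem_iff.1 hμ ?_
    have h1 : algebraMap ℂ (Matrix (Fin d) (Fin d) ℂ) μ - diagConj U (fun i => (r i : ℂ)) =
        diagConj U (fun i => μ - r i) := by
      rw [sub_eq_iff_eq_add, ← diagConj_add, Algebra.algebraMap_eq_smul_one, ← diagConj_const hU']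
      congr 1
      ext i
      simp
    have h2 : ∀ i, μ - (r i : ℂ) ≠ 0 := by
      intro i h0
      rw [sub_eq_zero] at h0
      rw [h0, Complex.ofReal_re] at hre
      exact hre (hr0 i)
    rw [h1]
    refine IsUnit.of_mul_eq_one (diagConj U (fun i => (μ - r i)⁻¹)) ?_
    rw [diagConj_mul hU]
    have : ((fun i => μ - (r i : ℂ)) * fun i => (μ - (r i : ℂ))⁻¹) = fun _ => (1 : ℂ) := by
      ext i
      exact mul_inv_cancel₀ (h2 i)
    rw [this, diagConj_const hU', one_smul]
  -- In the eigenbasis the resolvent is diagonal, reducing the claim to `∫ (u² + r²)⁻¹ du = π / r`.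
  · have h1 : ∀ u : ℝ, (((u : ℂ) ^ 2) • (1 : Matrix (Fin d) (Fin d) ℂ) + B)⁻¹ i j =
        ∑ k, ((u ^ 2 + r k ^ 2)⁻¹ : ℝ) * (U i k * star (U j k)) := by
      intro u
      have h2 : ((u : ℂ) ^ 2) • (1 : Matrix (Fin d) (Fin d) ℂ) + B =
          diagConj U (fun k => ((u ^ 2 + r k ^ 2 : ℝ) : ℂ)) := by
        rw [← diagConj_const hU', hBU, ← diagConj_add]
        congr 1
        ext k
        simp [← hr2 k]
      rw [h2, diagConj_inv hU, diagConj_apply]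
      · simp
      · intro k
        have := hr0 k
        exact_mod_cast (by positivity : (u ^ 2 + r k ^ 2 : ℝ) ≠ 0)
    simp only [h1]
    rw [integral_finsetSum, diagConj_inv hU, diagConj_apply, Finset.mul_sum]
    · refine Finset.sum_congr rfl fun k _ => ?_
      rw [integral_mul_const, integral_complex_ofReal, integral_univ_inv_sq_add_sq (hr0 k)]
      simp [mul_assoc]
    · intro k
      exact_mod_cast (hr0 k).ne'
    · intro k _
      exact ((integrable_inv_sq_add_sq (hr0 k)).ofReal).mul_const _

end Spectral

/-! ### Holomorphy of parameter integrals and of matrix inverses. -/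

/-- Holomorphic dependence on a parameter of an integral with locally dominated integrand. -/
theorem differentiableOn_integral_of_dominated {α : Type*} [MeasurableSpace α] {μ : Measure α}
    {U : Set ℂ} (hU : IsOpen U) {f : ℂ → α → ℂ} (hd : ∀ u, DifferentiableOn ℂ (fun z => f z u) U)
    (hm : ∀ z ∈ U, AEStronglyMeasurable (f z) μ)
    (hb : ∀ w ∈ U, ∃ b : α → ℝ, Integrable b μ ∧ ∀ᶠ z in 𝓝 w, ∀ u, ‖f z u‖ ≤ b u) :
    DifferentiableOn ℂ (fun z => ∫ u, f z u ∂μ) U := by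
  intro w hw
  obtain ⟨b, hbi, hbz⟩ := hb w hw
  obtain ⟨ε, hε, hball⟩ := Metric.eventually_nhds_iff_ball.1 (hbz.and (hU.mem_nhds hw))
  have hε2 : 0 < ε / 2 := half_pos hε
  have hsub : ∀ x ∈ Metric.ball w (ε / 2), ∀ y ∈ Metric.closedBall x (ε / 4), y ∈ Metric.ball w ε :=
    fun x hx y hy => by
      have := dist_triangle y x w
      rw [Metric.mem_ball] at hx ⊢
      rw [Metric.mem_closedBall] at hy
      linarith
  have hdx : ∀ x ∈ Metric.ball w ε, ∀ u, HasDerivAt (fun z => f z u) (deriv (fun z => f z u) x) x :=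
    fun x hx u => ((hd u x (hball x hx).2).differentiableAt (hU.mem_nhds (hball x hx).2)).hasDerivAt
  have hwball : w ∈ Metric.ball w ε := Metric.mem_ball_self hε
  have key := hasDerivAt_integral_of_dominated_loc_of_deriv_le (μ := μ) (F := f) (x₀ := w)
    (F' := fun z u => deriv (fun z => f z u) z) (bound := fun u => b u / (ε / 4))
    (s := Metric.ball w (ε / 2)) (Metric.ball_mem_nhds w hε2)
    (by filter_upwards [hU.mem_nhds hw] with z hz using hm z hz)
    (hbi.mono' (hm w hw) (ae_of_all _ fun u => (hball w hwball).1 u)) ?_ ?_ (hbi.div_const _) ?_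
  · exact key.2.differentiableAt.differentiableWithinAt
  -- The derivative is measurable in `u` as a pointwise limit of difference quotients along a
  -- sequence tending to `w`.
  · have hlim : Tendsto (fun k : ℕ => (w + ((ε / 2) * (1 / ((k : ℝ) + 1)) : ℝ) : ℂ)) atTop
        (𝓝[≠] w) := by
      refine tendsto_nhdsWithin_iff.2 ⟨?_, Eventually.of_forall fun k => ?_⟩
      · have h1 := (tendsto_one_div_add_atTop_nhds_zero_nat (𝕜 := ℝ)).const_mul (ε / 2)
        rw [mul_zero] at h1
        have h2 := ((Complex.continuous_ofReal.tendsto 0).comp h1).const_add w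
        simpa using h2
      · rw [mem_compl_iff, mem_singleton_iff, add_eq_left, Complex.ofReal_eq_zero]
        positivity
    refine aestronglyMeasurable_of_tendsto_ae atTop
      (f := fun k : ℕ => fun u => slope (fun z => f z u) w
        (w + ((ε / 2) * (1 / ((k : ℝ) + 1)) : ℝ))) (fun k => ?_)
      (ae_of_all _ fun u => (hasDerivAt_iff_tendsto_slope.1 (hdx w hwball u)).comp hlim)
    have hk : (w + ((ε / 2) * (1 / ((k : ℝ) + 1)) : ℝ) : ℂ) ∈ U := by
      refine (hball _ ?_).2
      rw [Metric.mem_ball, dist_eq_norm, add_sub_cancel_left, Complex.norm_real,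
        Real.norm_of_nonneg (by positivity)]
      have h1 : 1 / ((k : ℝ) + 1) ≤ 1 := by
        rw [div_le_one (by positivity)]
        have : (0 : ℝ) ≤ k := Nat.cast_nonneg k
        linarith
      nlinarith
    simp only [slope_def_field]
    simp only [div_eq_mul_inv]
    exact AEStronglyMeasurable.mul_const ((hm _ hk).sub (hm w hw)) _
  -- Cauchy's estimate on discs of radius `ε / 4` bounds the derivative by `b u / (ε / 4)`.
  · refine ae_of_all _ fun u x hx => ?_
    refine Complex.norm_deriv_le_of_forall_mem_sphere_norm_le (by positivity) ?_ fun z hz => ?_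
    · refine DifferentiableOn.diffContOnCl fun y hy => ?_
      have hy' := hsub x hx y (Metric.closure_ball_subset_closedBall hy)
      exact (hdx y hy' u).differentiableAt.differentiableWithinAt
    · exact (hball z (hsub x hx z (Metric.sphere_subset_closedBall hz))).1 u
  · refine ae_of_all _ fun u x hx => hdx x (Metric.ball_subset_ball (by linarith) hx) u

section Entries
open Matrix
variable {d : ℕ}

theorem DifferentiableOn.matrix_det {M : ℂ → Matrix (Fin d) (Fin d) ℂ} {U : Set ℂ}
    (h : ∀ i j, DifferentiableOn ℂ (fun z => M z i j) U) :
    DifferentiableOn ℂ (fun z => (M z).det) U := by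
  simp only [det_apply]
  exact DifferentiableOn.fun_sum fun σ _ =>
    (DifferentiableOn.fun_finsetProd fun i _ => h _ _).const_smul _

theorem DifferentiableOn.matrix_inv_apply {M : ℂ → Matrix (Fin d) (Fin d) ℂ} {U : Set ℂ}
    (h : ∀ i j, DifferentiableOn ℂ (fun z => M z i j) U) (h0 : ∀ z ∈ U, (M z).det ≠ 0)
    (i j : Fin d) : DifferentiableOn ℂ (fun z => (M z)⁻¹ i j) U := by
  simp only [inv_def, Matrix.smul_apply, Ring.inverse_eq_inv', adjugate_apply, smul_eq_mul]
  refine ((DifferentiableOn.matrix_det h).inv h0).mul (DifferentiableOn.matrix_det fun k l => ?_)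
  by_cases hk : k = j
  · subst hk
    simp
  · simpa [updateRow_ne hk] using h k l

theorem Matrix.star_dotProduct_self_eq (v : Fin d → ℂ) :
    star v ⬝ᵥ v = ((∑ i, ‖v i‖ ^ 2 : ℝ) : ℂ) := by
  rw [dotProduct, Complex.ofReal_sum]
  refine Finset.sum_congr rfl fun i _ => ?_
  rw [Pi.star_apply, Complex.star_def, Complex.conj_mul', Complex.ofReal_pow]

end Entries

/-! ### Sectorial matrix families and their inverse square roots. -/

section Sectorial
open Matrix

/-- A holomorphic matrix function on the slit plane whose numerical range at `z` lies in the sector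
between `arg z` and `0`, uniformly away from the origin, and which is real symmetric on `]0,∞[`. -/
structure IsSectorialFamily {d : ℕ} (Q : ℂ → Matrix (Fin d) (Fin d) ℂ) (γ : ℝ) : Prop where
  pos : 0 < γ
  differentiableOn : ∀ i j, DifferentiableOn ℂ (fun z => Q z i j) Complex.slitPlane
  le_re : ∀ z ∈ Complex.slitPlane, ∀ v : Fin d → ℂ,
    (slitSqrt z).re * (γ * ∑ i, ‖v i‖ ^ 2) ≤ (conj (slitSqrt z) * (star v ⬝ᵥ Q z *ᵥ v)).re
  nonneg : ∀ z ∈ Complex.slitPlane, ∀ v : Fin d → ℂ,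
    0 ≤ ((z.im : ℂ) * Complex.I * conj z * (star v ⬝ᵥ Q z *ᵥ v)).re
  isHermitian : ∀ p : ℝ, 0 < p → (Q p).IsHermitian
  real : ∀ p : ℝ, 0 < p → ∀ i j, (Q p i j).im = 0

namespace IsSectorialFamily
variable {d : ℕ} {Q : ℂ → Matrix (Fin d) (Fin d) ℂ} {γ : ℝ}

theorem dotProduct_shift (B : Matrix (Fin d) (Fin d) ℂ) (c : ℂ) (v : Fin d → ℂ) :
    star v ⬝ᵥ (c • (1 : Matrix (Fin d) (Fin d) ℂ) + B) *ᵥ v =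
      c * ((∑ i, ‖v i‖ ^ 2 : ℝ) : ℂ) + star v ⬝ᵥ B *ᵥ v := by
  rw [add_mulVec, dotProduct_add, smul_mulVec, one_mulVec, dotProduct_smul,
    star_dotProduct_self_eq, smul_eq_mul]

/-- Both sector inequalities hold for positive constants, so adding `u²` preserves them and raises
the coercivity constant. -/
theorem shift (h : IsSectorialFamily Q γ) (u : ℝ) :
    IsSectorialFamily (fun z => ((u : ℂ) ^ 2) • (1 : Matrix (Fin d) (Fin d) ℂ) + Q z)
      (u ^ 2 + γ) where
  pos := by have := h.pos; positivity
  differentiableOn i j := by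
    simp only [Matrix.add_apply]
    exact (h.differentiableOn i j).const_add _
  le_re z hz v := by
    have h1 := h.le_re z hz v
    rw [dotProduct_shift, mul_add, Complex.add_re, ← Complex.ofReal_pow, ← Complex.ofReal_mul,
      Complex.re_mul_ofReal, Complex.conj_re]
    linarith
  nonneg z hz v := by
    have h1 := h.nonneg z hz v
    rw [dotProduct_shift, mul_add, Complex.add_re, ← Complex.ofReal_pow, ← Complex.ofReal_mul,
      Complex.re_mul_ofReal]
    refine add_nonneg (mul_nonneg ?_ (by positivity)) h1
    simp
    exact mul_self_nonneg _
  isHermitian p hp := by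
    refine IsHermitian.add ?_ (h.isHermitian p hp)
    rw [IsHermitian, conjTranspose_smul, conjTranspose_one]
    simp
  real p hp i j := by
    rw [Matrix.add_apply, Complex.add_im, h.real p hp, add_zero, Matrix.smul_apply, one_apply,
      ← Complex.ofReal_pow, smul_eq_mul, Complex.im_ofReal_mul]
    split_ifs <;> simp

theorem det_ne_zero (h : IsSectorialFamily Q γ) {z : ℂ} (hz : z ∈ Complex.slitPlane) :
    (Q z).det ≠ 0 := by
  intro h0
  obtain ⟨v, hv, hv0⟩ := exists_mulVec_eq_zero_iff.2 h0
  have h1 := h.le_re z hz v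
  rw [hv0, dotProduct_zero, mul_zero, Complex.zero_re] at h1
  have h2 : 0 < ∑ i, ‖v i‖ ^ 2 := by
    obtain ⟨i, hi⟩ := Function.ne_iff.1 hv
    exact Finset.sum_pos' (fun _ _ => by positivity) ⟨i, Finset.mem_univ _, by
      have : 0 < ‖v i‖ := norm_pos_iff.2 hi
      positivity⟩
  have := slitSqrt_re_pos hz
  have := h.pos
  have : 0 < (slitSqrt z).re * (γ * ∑ i, ‖v i‖ ^ 2) := by positivity
  linarith

theorem mulVec_inv_mulVec (h : IsSectorialFamily Q γ) {z : ℂ} (hz : z ∈ Complex.slitPlane)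
    (v : Fin d → ℂ) : Q z *ᵥ ((Q z)⁻¹ *ᵥ v) = v := by
  rw [mulVec_mulVec, mul_nonsing_inv _ (isUnit_iff_ne_zero.2 (h.det_ne_zero hz)), one_mulVec]

/-- Coercivity applied to the `j`-th column `w` of the inverse: `Re √z · γ |w|² ≤ |√z| |w|`. -/
theorem norm_inv_apply_le (h : IsSectorialFamily Q γ) {z : ℂ} (hz : z ∈ Complex.slitPlane)
    (i j : Fin d) : ‖(Q z)⁻¹ i j‖ ≤ aperture z * γ⁻¹ := by
  set w : Fin d → ℂ := (Q z)⁻¹ *ᵥ Pi.single j 1 with hw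
  have hwi : ∀ i, w i = (Q z)⁻¹ i j := fun i => by rw [hw, mulVec_single_one]; rfl
  have h1 := h.le_re z hz w
  rw [hw, h.mulVec_inv_mulVec hz, ← hw, dotProduct_single, mul_one] at h1
  set N := Real.sqrt (∑ i, ‖w i‖ ^ 2) with hN
  have hN2 : N ^ 2 = ∑ i, ‖w i‖ ^ 2 := Real.sq_sqrt (Finset.sum_nonneg fun _ _ => by positivity)
  have hle : ∀ i, ‖w i‖ ≤ N := fun i => by
    refine Real.le_sqrt_of_sq_le ?_
    exact Finset.single_le_sum (f := fun i => ‖w i‖ ^ 2) (fun _ _ => by positivity)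
      (Finset.mem_univ i)
  have h2 : (conj (slitSqrt z) * star w j).re ≤ ‖slitSqrt z‖ * N := by
    refine (Complex.re_le_norm _).trans ?_
    rw [norm_mul, Complex.norm_conj, Pi.star_apply, norm_star]
    exact mul_le_mul_of_nonneg_left (hle j) (norm_nonneg _)
  rw [← hN2] at h1
  have hσ := slitSqrt_re_pos hz
  have hγ := h.pos
  have hN0 : 0 ≤ N := Real.sqrt_nonneg _
  rw [← hwi i]
  refine (hle i).trans ?_
  rw [aperture, ← div_eq_mul_inv, div_div, le_div_iff₀ (by positivity)]
  rcases hN0.eq_or_lt with h0 | h0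
  · rw [← h0]
    simp
  · refine le_of_mul_le_mul_right ?_ h0
    nlinarith

/-- With `w = Q⁻¹ v`, the form of the inverse at `v` is the conjugate of the form of `Q` at `w`. The
real part here is `Im z` times the imaginary part of `z` times the form. -/
theorem re_dotProduct_inv_nonneg (h : IsSectorialFamily Q γ) {z : ℂ} (hz : z ∈ Complex.slitPlane)
    (v : Fin d → ℂ) : 0 ≤ (-(z.im : ℂ) * Complex.I * z * (star v ⬝ᵥ (Q z)⁻¹ *ᵥ v)).re := by
  set w : Fin d → ℂ := (Q z)⁻¹ *ᵥ v with hw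
  have h1 := h.nonneg z hz w
  rw [hw, h.mulVec_inv_mulVec hz, ← hw] at h1
  have h2 : star v ⬝ᵥ w = conj (star w ⬝ᵥ v) := by
    rw [← Complex.star_def, star_dotProduct]
  rw [h2, ← Complex.conj_re]
  simpa using h1

theorem posDef (h : IsSectorialFamily Q γ) {p : ℝ} (hp : 0 < p) : (Q p).PosDef := by
  have hz : (p : ℂ) ∈ Complex.slitPlane := by simpa using hp
  refine PosDef.of_dotProduct_mulVec_pos (h.isHermitian p hp) fun v hv => ?_
  have him : (star v ⬝ᵥ Q p *ᵥ v).im = 0 := (h.isHermitian p hp).im_star_dotProduct_mulVec_self v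
  rw [Complex.pos_iff]
  refine ⟨?_, him.symm⟩
  have h1 := h.le_re p hz v
  rw [slitSqrt_ofReal hp, Complex.conj_ofReal, Complex.re_ofReal_mul, Complex.ofReal_re] at h1
  have h2 : 0 < ∑ i, ‖v i‖ ^ 2 := by
    obtain ⟨i, hi⟩ := Function.ne_iff.1 hv
    exact Finset.sum_pos' (fun _ _ => by positivity) ⟨i, Finset.mem_univ _, by
      have : 0 < ‖v i‖ := norm_pos_iff.2 hi
      positivity⟩
  exact (mul_pos h.pos h2).trans_le (le_of_mul_le_mul_left h1 (Real.sqrt_pos.2 hp))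

theorem inv_apply_im (h : IsSectorialFamily Q γ) {p : ℝ} (hp : 0 < p) (i j : Fin d) :
    ((Q p)⁻¹ i j).im = 0 := by
  have hz : (p : ℂ) ∈ Complex.slitPlane := by simpa using hp
  have hdet := h.det_ne_zero hz
  have h1 : (Q p).map (starRingEnd ℂ) = Q p := by
    ext i j
    rw [map_apply, Complex.conj_eq_iff_im]
    exact h.real p hp i j
  have h2 : ((Q p)⁻¹).map (starRingEnd ℂ) = (Q p)⁻¹ := by
    symm
    refine inv_eq_right_inv ?_
    nth_rewrite 1 [← h1]
    rw [← Matrix.map_mul, mul_nonsing_inv _ (isUnit_iff_ne_zero.2 hdet)]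
    simp
  rw [← Complex.conj_eq_iff_im]
  exact congrFun (congrFun h2 i) j

theorem norm_shift_inv_apply_le (h : IsSectorialFamily Q γ) (u : ℝ) {z : ℂ}
    (hz : z ∈ Complex.slitPlane)
    (i j : Fin d) :
    ‖(((u : ℂ) ^ 2) • (1 : Matrix (Fin d) (Fin d) ℂ) + Q z)⁻¹ i j‖ ≤
      aperture z * (u ^ 2 + γ)⁻¹ :=
  (h.shift u).norm_inv_apply_le hz i j

theorem integrable_bound (h : IsSectorialFamily Q γ) : Integrable fun u : ℝ => (u ^ 2 + γ)⁻¹ := by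
  have h1 := integrable_inv_sq_add_sq (Real.sqrt_pos.2 h.pos)
  rwa [Real.sq_sqrt h.pos.le] at h1

theorem aestronglyMeasurable_inv_apply (h : IsSectorialFamily Q γ) {z : ℂ}
    (hz : z ∈ Complex.slitPlane) (i j : Fin d) :
    AEStronglyMeasurable (fun u : ℝ =>
      (((u : ℂ) ^ 2) • (1 : Matrix (Fin d) (Fin d) ℂ) + Q z)⁻¹ i j) volume := by
  refine Continuous.aestronglyMeasurable ?_
  have hc : Continuous fun u : ℝ => ((u : ℂ) ^ 2) • (1 : Matrix (Fin d) (Fin d) ℂ) + Q z := by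
    fun_prop
  simp only [inv_def, Matrix.smul_apply, Ring.inverse_eq_inv', smul_eq_mul]
  exact (hc.matrix_det.inv₀ fun u => (h.shift u).det_ne_zero hz).mul
    (hc.matrix_adjugate.matrix_elem i j)

theorem integrable_inv_apply (h : IsSectorialFamily Q γ) {z : ℂ} (hz : z ∈ Complex.slitPlane)
    (i j : Fin d) :
    Integrable fun u : ℝ => (((u : ℂ) ^ 2) • (1 : Matrix (Fin d) (Fin d) ℂ) + Q z)⁻¹ i j :=
  (h.integrable_bound.const_mul (aperture z)).mono' (h.aestronglyMeasurable_inv_apply hz i j)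
    (ae_of_all _ fun u => h.norm_shift_inv_apply_le u hz i j)

/-- The integral `∫ (u ^ 2 + Q z)⁻¹ du`, that is `π Q(z)^{-1/2}`. -/
noncomputable def _root_.resolventIntegral (Q : ℂ → Matrix (Fin d) (Fin d) ℂ) (z : ℂ) :
    Matrix (Fin d) (Fin d) ℂ :=
  of fun i j => ∫ u : ℝ, (((u : ℂ) ^ 2) • (1 : Matrix (Fin d) (Fin d) ℂ) + Q z)⁻¹ i j

theorem differentiableOn_resolventIntegral (h : IsSectorialFamily Q γ) (i j : Fin d) :
    DifferentiableOn ℂ (fun z => resolventIntegral Q z i j) Complex.slitPlane := by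
  refine differentiableOn_integral_of_dominated Complex.isOpen_slitPlane (fun u => ?_)
    (fun z hz => h.aestronglyMeasurable_inv_apply hz i j) fun w hw => ?_
  · exact DifferentiableOn.matrix_inv_apply (h.shift u).differentiableOn
      (fun z hz => (h.shift u).det_ne_zero hz) i j
  · refine ⟨fun u => (aperture w + 1) * (u ^ 2 + γ)⁻¹, h.integrable_bound.const_mul _, ?_⟩
    filter_upwards [Complex.isOpen_slitPlane.mem_nhds hw,
      (continuousAt_aperture hw).eventually_lt continuousAt_const (lt_add_one _)] with z hz hzw u
    have := h.pos
    exact (h.norm_shift_inv_apply_le u hz i j).trans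
      (mul_le_mul_of_nonneg_right hzw.le (by positivity))

theorem norm_resolventIntegral_le (h : IsSectorialFamily Q γ) {z : ℂ}
    (hz : z ∈ Complex.slitPlane) (i j : Fin d) :
    ‖resolventIntegral Q z i j‖ ≤ aperture z * ∫ u : ℝ, (u ^ 2 + γ)⁻¹ := by
  rw [← integral_const_mul]
  exact norm_integral_le_of_norm_le (h.integrable_bound.const_mul _)
    (ae_of_all _ fun u => h.norm_shift_inv_apply_le u hz i j)

theorem resolventIntegral_im (h : IsSectorialFamily Q γ) {p : ℝ} (hp : 0 < p) (i j : Fin d) :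
    (resolventIntegral Q p i j).im = 0 := by
  have hz : (p : ℂ) ∈ Complex.slitPlane := by simpa using hp
  rw [resolventIntegral, of_apply, ← RCLike.im_eq_complex_im,
    ← integral_im (h.integrable_inv_apply hz i j)]
  refine integral_eq_zero_of_ae (ae_of_all _ fun u => ?_)
  exact (h.shift u).inv_apply_im hp i j

theorem re_dotProduct_resolventIntegral_nonneg (h : IsSectorialFamily Q γ) {z : ℂ}
    (hz : z ∈ Complex.slitPlane) (v : Fin d → ℂ) :
    0 ≤ (-(z.im : ℂ) * Complex.I * z * (star v ⬝ᵥ resolventIntegral Q z *ᵥ v)).re := by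
  have e : ∀ M : Matrix (Fin d) (Fin d) ℂ, star v ⬝ᵥ M *ᵥ v =
      ∑ i, ∑ j, star (v i) * (M i j * v j) := fun M => by
    simp only [dotProduct, mulVec, Finset.mul_sum, Pi.star_apply]
  have hi : ∀ i j, Integrable fun u : ℝ => star (v i) *
      ((((u : ℂ) ^ 2) • (1 : Matrix (Fin d) (Fin d) ℂ) + Q z)⁻¹ i j * v j) := fun i j =>
    ((h.integrable_inv_apply hz i j).mul_const _).const_mul _
  have hI : star v ⬝ᵥ resolventIntegral Q z *ᵥ v = ∫ u : ℝ,
      star v ⬝ᵥ (((u : ℂ) ^ 2) • (1 : Matrix (Fin d) (Fin d) ℂ) + Q z)⁻¹ *ᵥ v := by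
    simp only [e]
    rw [integral_finsetSum _ fun i _ => integrable_finsetSum _ fun j _ => hi i j]
    refine Finset.sum_congr rfl fun i _ => ?_
    rw [integral_finsetSum _ fun j _ => hi i j]
    refine Finset.sum_congr rfl fun j _ => ?_
    rw [integral_const_mul, integral_mul_const]
    rfl
  have hint : Integrable fun u : ℝ =>
      star v ⬝ᵥ (((u : ℂ) ^ 2) • (1 : Matrix (Fin d) (Fin d) ℂ) + Q z)⁻¹ *ᵥ v := by
    simp only [e]
    exact integrable_finsetSum _ fun i _ => integrable_finsetSum _ fun j _ => hi i j
  rw [hI, ← integral_const_mul, ← RCLike.re_eq_complex_re, ← integral_re (hint.const_mul _)]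
  exact integral_nonneg fun u => (h.shift u).re_dotProduct_inv_nonneg hz v

theorem isPrincipalSqrt (h : IsSectorialFamily Q γ) {p : ℝ} (hp : 0 < p) :
    IsPrincipalSqrt (Q p) (principalSqrt (Q p)) := by
  obtain ⟨Y, hY, -⟩ := (h.posDef hp).exists_isPrincipalSqrt
  rwa [hY.principalSqrt_eq]

theorem inv_principalSqrt (h : IsSectorialFamily Q γ) {p : ℝ} (hp : 0 < p) :
    (principalSqrt (Q p))⁻¹ = (Real.pi : ℂ)⁻¹ • resolventIntegral Q p := by
  obtain ⟨Y, hY, hY2⟩ := (h.posDef hp).exists_isPrincipalSqrt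
  rw [hY.principalSqrt_eq]
  ext i j
  rw [Matrix.smul_apply, resolventIntegral, of_apply, hY2, smul_eq_mul, inv_mul_cancel_left₀]
  exact_mod_cast Real.pi_ne_zero

theorem _root_.Matrix.star_dotProduct_imaginaryPart_mulVec (M : Matrix (Fin d) (Fin d) ℂ)
    (v : Fin d → ℂ) :
    star v ⬝ᵥ (ℑ M : Matrix (Fin d) (Fin d) ℂ) *ᵥ v = ((star v ⬝ᵥ M *ᵥ v).im : ℂ) := by
  have h1 : star v ⬝ᵥ star M *ᵥ v = conj (star v ⬝ᵥ M *ᵥ v) := by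
    rw [← Complex.star_def, star_dotProduct, star_mulVec, star_eq_conjTranspose,
      conjTranspose_conjTranspose, dotProduct_mulVec]
  rw [imaginaryPart_apply_coe, smul_mulVec, smul_mulVec, sub_mulVec, dotProduct_smul,
    dotProduct_smul, dotProduct_sub, h1, Complex.sub_conj, Complex.real_smul, smul_eq_mul]
  push_cast
  linear_combination (-(star v ⬝ᵥ M *ᵥ v).im : ℂ) * Complex.I_mul_I

theorem isMatrixCBF (h : IsSectorialFamily Q γ) {c : ℝ} (hc : 0 ≤ c)
    {A : ℝ → Matrix (Fin d) (Fin d) ℂ} (hA0 : A 0 = 0)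
    (hA : ∀ p : ℝ, 0 < p → A p = ((c : ℂ) * p) • (principalSqrt (Q p))⁻¹) : IsMatrixCBF A := by
  have hπ := Real.pi_pos
  obtain ⟨F, hF⟩ : ∃ F : ℂ → Matrix (Fin d) (Fin d) ℂ,
      ∀ z, F z = ((c / Real.pi : ℝ) * z) • resolventIntegral Q z := ⟨_, fun _ => rfl⟩
  have hFA : ∀ p : ℝ, 0 < p → F p = A p := fun p hp => by
    rw [hA p hp, h.inv_principalSqrt hp, smul_smul, hF]
    congr 1
    push_cast
    ring
  refine ⟨fun x hx i j => ?_, ⟨F, fun i j => ?_, hFA, fun z hz => ?_⟩, ?_, ?_⟩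
  · rcases hx.eq_or_lt with rfl | hx
    · simp [hA0]
    · rw [← hFA x hx, hF, Matrix.smul_apply, ← Complex.ofReal_mul, smul_eq_mul,
        Complex.im_ofReal_mul, h.resolventIntegral_im hx, mul_zero]
  · simp only [hF, Matrix.smul_apply, smul_eq_mul]
    exact (differentiableOn_id.const_mul _).mul (h.differentiableOn_resolventIntegral i j)
  · refine PosSemidef.of_dotProduct_mulVec_nonneg ?_ fun v => ?_
    · have : (ℑ (F z) : Matrix (Fin d) (Fin d) ℂ).IsHermitian := (ℑ (F z)).2
      rw [IsHermitian, conjTranspose_smul, this, star_trivial]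
    · rw [smul_mulVec, dotProduct_smul, star_dotProduct_imaginaryPart_mulVec, Complex.real_smul,
        ← Complex.ofReal_mul]
      rw [Complex.zero_le_real]
      have h1 := h.re_dotProduct_resolventIntegral_nonneg hz v
      have h2 : z.im * (star v ⬝ᵥ F z *ᵥ v).im = c / Real.pi *
          (-(z.im : ℂ) * Complex.I * z * (star v ⬝ᵥ resolventIntegral Q z *ᵥ v)).re := by
        rw [hF, smul_mulVec, dotProduct_smul, smul_eq_mul, mul_assoc, Complex.im_ofReal_mul]
        simp only [mul_assoc, ← Complex.ofReal_neg, Complex.re_ofReal_mul, Complex.I_mul_re]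
        ring
      rw [h2]
      positivity
  · rw [hA0]
    refine tendsto_pi_nhds.2 fun i => tendsto_pi_nhds.2 fun j => ?_
    rw [Matrix.zero_apply]
    have hlim : Tendsto (fun p : ℝ => c / Real.pi * p * ∫ u : ℝ, (u ^ 2 + γ)⁻¹) (𝓝[>] 0)
        (𝓝 0) := by
      have h1 : Tendsto (fun p : ℝ => c / Real.pi * p * ∫ u : ℝ, (u ^ 2 + γ)⁻¹) (𝓝 0)
        (𝓝 (c / Real.pi * 0 * ∫ u : ℝ, (u ^ 2 + γ)⁻¹)) := Continuous.tendsto (by fun_prop) 0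
      rw [mul_zero, zero_mul] at h1
      exact h1.mono_left nhdsWithin_le_nhds
    refine squeeze_zero_norm' ?_ hlim
    filter_upwards [self_mem_nhdsWithin] with p hp
    have hp : 0 < p := hp
    have hz : (p : ℂ) ∈ Complex.slitPlane := by simpa using hp
    rw [← hFA p hp, hF, Matrix.smul_apply, smul_eq_mul, ← Complex.ofReal_mul, norm_mul,
      Complex.norm_real, Real.norm_of_nonneg (by positivity)]
    refine mul_le_mul_of_nonneg_left ?_ (by positivity)
    have h1 := h.norm_resolventIntegral_le hz i j
    -- On the positive axis the entrywise bound does not depend on `p`, so the prefactor `p` forces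
    -- the limit `0`.
    have h2 : aperture p = 1 := by
      rw [aperture, slitSqrt_ofReal hp, Complex.norm_real, Complex.ofReal_re,
        Real.norm_of_nonneg (Real.sqrt_nonneg _), div_self (Real.sqrt_pos.2 hp).ne']
    rwa [h2, one_mul] at h1
  · rw [hA0]
    exact PosSemidef.zero

end IsSectorialFamily

end Sectorial

/-- Identity theorem on the connected slit plane, with `1` as accumulation point. -/
theorem eqOn_slitPlane_of_eq_on_pos {f g : ℂ → ℂ} (hf : DifferentiableOn ℂ f Complex.slitPlane)
    (hg : DifferentiableOn ℂ g Complex.slitPlane) (h : ∀ p : ℝ, 0 < p → f p = g p) :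
    EqOn f g Complex.slitPlane := by
  refine (hf.analyticOnNhd Complex.isOpen_slitPlane).eqOn_of_preconnected_of_frequently_eq
    (hg.analyticOnNhd Complex.isOpen_slitPlane)
    (Complex.starConvex_one_slitPlane.isPathConnected
      Complex.one_mem_slitPlane).isConnected.isPreconnected
    Complex.one_mem_slitPlane ?_
  have hlim : Tendsto (fun t : ℝ => (t : ℂ)) (𝓝[>] 1) (𝓝[≠] 1) := by
    refine tendsto_nhdsWithin_iff.2 ⟨?_, ?_⟩
    · exact (Complex.continuous_ofReal.tendsto 1).mono_left nhdsWithin_le_nhds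
    · filter_upwards [self_mem_nhdsWithin] with t ht
      have : t ≠ 1 := (mem_Ioi.1 ht).ne'
      rw [mem_compl_iff, mem_singleton_iff]
      exact_mod_cast this
  refine hlim.frequently (Eventually.frequently ?_)
  filter_upwards [self_mem_nhdsWithin] with t ht
  exact h t (zero_lt_one.trans ht)

/-! ### Symmetric tensors and the quadratic form of the projected modulus. -/

section SymDot
variable {d : ℕ}

/-- The scalar product of symmetric tensors as a bilinear map. -/
noncomputable def symDotBilin (d : ℕ) : SymTensor d →ₗ[ℝ] SymTensor d →ₗ[ℝ] ℝ :=
  LinearMap.mk₂ ℝ symDot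
    (fun E F C => by simp [symDot, add_mul, Finset.sum_add_distrib])
    (fun c E C => by simp [symDot, mul_assoc, Finset.mul_sum])
    (fun E F C => by simp [symDot, mul_add, Finset.sum_add_distrib])
    (fun c E C => by simp [symDot, mul_left_comm, Finset.mul_sum])

theorem symDotBilin_apply (E C : SymTensor d) : symDotBilin d E C = symDot E C := rfl

theorem continuous_symDot (E : SymTensor d) : Continuous (symDot E) := by
  unfold symDot
  refine continuous_finsetSum _ fun i _ => continuous_finsetSum _ fun j _ => ?_
  exact continuous_const.mul (continuous_subtype_val.matrix_elem i j)

theorem symDyad_apply (k l i j : Fin d) : (symDyad k l : Matrix (Fin d) (Fin d) ℝ) i j =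
    (1 / 2 : ℝ) * ((if k = i ∧ l = j then 1 else 0) + if l = i ∧ k = j then 1 else 0) := by
  simp [symDyad, Matrix.single_apply, mul_add]

theorem symDot_symDyad (k l : Fin d) (E : SymTensor d) :
    symDot (symDyad k l) E = (E : Matrix (Fin d) (Fin d) ℝ) k l := by
  have h : (E : Matrix (Fin d) (Fin d) ℝ) l k = (E : Matrix (Fin d) (Fin d) ℝ) k l := E.2.apply k l
  have e : ∀ a b : Fin d, ∑ i, ∑ j, (if a = i ∧ b = j then (1 : ℝ) else 0) *
      (E : Matrix (Fin d) (Fin d) ℝ) i j = (E : Matrix (Fin d) (Fin d) ℝ) a b := by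
    intro a b
    simp [ite_and]
  simp only [symDot, symDyad_apply, mul_assoc, add_mul, ← Finset.mul_sum, Finset.sum_add_distrib, e]
  rw [h]
  ring

theorem component_eq_symDot (H : SymTensor d →ₗ[ℝ] SymTensor d) (i j k l : Fin d) :
    component H i j k l = symDot (symDyad i j) (H (symDyad k l)) := (symDot_symDyad _ _ _).symm

/-- The symmetrized dyad of the `i`-th basis vector with `n`. -/
noncomputable def polarDyad (n : EuclideanSpace ℝ (Fin d)) (i : Fin d) : SymTensor d :=
  ∑ j, n j • symDyad i j

/-- The symmetrized dyad of `a` and `n`. -/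
noncomputable def polarTensor (n : EuclideanSpace ℝ (Fin d)) (a : Fin d → ℝ) : SymTensor d :=
  ∑ i, a i • polarDyad n i

theorem polarTensor_apply (n : EuclideanSpace ℝ (Fin d)) (a : Fin d → ℝ) (k l : Fin d) :
    (polarTensor n a : Matrix (Fin d) (Fin d) ℝ) k l = (a k * n l + a l * n k) / 2 := by
  have e : (polarTensor n a : Matrix (Fin d) (Fin d) ℝ) k l =
      ∑ i, a i * ∑ j, n j * (symDyad i j : Matrix (Fin d) (Fin d) ℝ) k l := by
    simp [polarTensor, polarDyad, Matrix.sum_apply]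
  rw [e]
  simp only [symDyad_apply, mul_add, Finset.sum_add_distrib]
  simp [ite_and]
  ring

/-- Injectivity of `a ↦ (a ⊗ n + n ⊗ a) / 2`: where `n l ≠ 0`, the diagonal entry kills `a l`, and
then the entries `(k, l)` kill every `a k`. -/
theorem polarTensor_ne_zero {n : EuclideanSpace ℝ (Fin d)} (hn : n ≠ 0) {a : Fin d → ℝ}
    (ha : a ≠ 0) : polarTensor n a ≠ 0 := by
  intro h
  have h1 : ∀ k l, (a k * n l + a l * n k) / 2 = 0 := fun k l => by
    rw [← polarTensor_apply, h]
    rfl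
  obtain ⟨l, hl⟩ : ∃ l, n l ≠ 0 := by
    by_contra hcon
    push Not at hcon
    exact hn (by ext l; simpa using hcon l)
  have h2 : a l = 0 := by
    have := h1 l l
    have : a l * n l = 0 := by linarith
    exact (mul_eq_zero.1 this).resolve_right hl
  refine ha (funext fun k => ?_)
  have h3 := h1 k l
  rw [h2] at h3
  have : a k * n l = 0 := by linarith
  exact (mul_eq_zero.1 this).resolve_right hl

theorem symDot_polarTensor (n : EuclideanSpace ℝ (Fin d)) (a : Fin d → ℝ)
    (H : SymTensor d →ₗ[ℝ] SymTensor d) : symDot (polarTensor n a) (H (polarTensor n a)) =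
      ∑ i, ∑ k, a i * a k * symDot (polarDyad n i) (H (polarDyad n k)) := by
  simp only [← symDotBilin_apply, polarTensor, map_sum, map_smul, LinearMap.sum_apply,
    LinearMap.smul_apply, smul_eq_mul, Finset.mul_sum]
  rw [Finset.sum_comm]
  refine Finset.sum_congr rfl fun i _ => Finset.sum_congr rfl fun k _ => ?_
  ring

theorem symDot_polarDyad (n : EuclideanSpace ℝ (Fin d)) (i k : Fin d)
    (H : SymTensor d →ₗ[ℝ] SymTensor d) : symDot (polarDyad n i) (H (polarDyad n k)) =
      ∑ j, ∑ l, component H i j k l * n j * n l := by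
  simp only [component_eq_symDot, ← symDotBilin_apply, polarDyad, map_sum, map_smul,
    LinearMap.sum_apply, LinearMap.smul_apply, smul_eq_mul, Finset.mul_sum]
  rw [Finset.sum_comm]
  refine Finset.sum_congr rfl fun i _ => Finset.sum_congr rfl fun k _ => ?_
  ring

/-- Compactness of the unit sphere and homogeneity of degree two turn positivity into coercivity. -/
theorem exists_pos_le_symDot_polarTensor {n : EuclideanSpace ℝ (Fin d)} (hn : n ≠ 0)
    {H : SymTensor d →ₗ[ℝ] SymTensor d} (hH : ∀ E, E ≠ 0 → 0 < symDot E (H E)) :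
    ∃ γ, 0 < γ ∧ ∀ a : Fin d → ℝ,
      γ * ∑ i, a i ^ 2 ≤ symDot (polarTensor n a) (H (polarTensor n a)) := by
  set h : EuclideanSpace ℝ (Fin d) → ℝ := fun x => symDot (polarTensor n x) (H (polarTensor n x))
    with hh
  have hc : Continuous h := by
    simp only [hh, symDot_polarTensor]
    fun_prop
  have hhom : ∀ (c : ℝ) (x : EuclideanSpace ℝ (Fin d)), h (c • x) = c ^ 2 * h x := fun c x => by
    simp only [hh, symDot_polarTensor, Finset.mul_sum, PiLp.smul_apply, smul_eq_mul]
    refine Finset.sum_congr rfl fun i _ => Finset.sum_congr rfl fun k _ => ?_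
    ring
  -- The normalized `n` itself shows that the sphere is nonempty, which excludes `d = 0`.
  have hne : (Metric.sphere (0 : EuclideanSpace ℝ (Fin d)) 1).Nonempty :=
    ⟨‖n‖⁻¹ • n, by simp [norm_smul, norm_ne_zero_iff.2 hn]⟩
  obtain ⟨x₀, hx₀, hmin⟩ := (isCompact_sphere (0 : EuclideanSpace ℝ (Fin d)) 1).exists_isMinOn hne
    hc.continuousOn
  have hx₀' : (x₀ : Fin d → ℝ) ≠ 0 := by
    intro h0
    have : x₀ = 0 := by
      ext i
      exact congrFun h0 i
    simp [this] at hx₀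
  refine ⟨h x₀, hH _ (polarTensor_ne_zero hn hx₀'), fun a => ?_⟩
  set x : EuclideanSpace ℝ (Fin d) := WithLp.toLp 2 a with hx
  have hsum : ∑ i, a i ^ 2 = ‖x‖ ^ 2 := by
    rw [EuclideanSpace.real_norm_sq_eq]
  rw [hsum]
  change h x₀ * ‖x‖ ^ 2 ≤ h x
  rcases eq_or_ne x 0 with h0 | h0
  · rw [h0]
    simpa using (hhom 0 0).symm.le
  · have hxn : ‖x‖ ≠ 0 := norm_ne_zero_iff.2 h0
    have h1 : h x₀ ≤ h (‖x‖⁻¹ • x) := hmin (by simp [norm_smul, hxn])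
    rw [hhom] at h1
    have h2 := mul_le_mul_of_nonneg_right h1 (sq_nonneg ‖x‖)
    refine h2.trans_eq ?_
    field_simp

end SymDot

/-! ### From the relaxation modulus to a sectorial family. -/

namespace IsSolidRelaxationModulus
variable {d : ℕ} {G : ℝ → SymTensor d →ₗ[ℝ] SymTensor d}

/-- Complete monotonicity concerns diagonal values only; symmetry of `G t` carries integrability and
continuation over to mixed ones. -/
theorem symDot_eq_polarization (hG : IsSolidRelaxationModulus G) {t : ℝ} (ht : 0 < t)
    (E C : SymTensor d) : symDot E (G t C) =
      2⁻¹ * (symDot (E + C) (G t (E + C)) - symDot E (G t E) - symDot C (G t C)) := by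
  have h := hG.symm t ht E C
  simp only [← symDotBilin_apply, map_add, LinearMap.add_apply] at h ⊢
  linarith

theorem exists_isCMSequence (hG : IsSolidRelaxationModulus G)
    {Ginf : SymTensor d →ₗ[ℝ] SymTensor d}
    (hinf : ∀ E, Tendsto (fun t => G t E) atTop (𝓝 (Ginf E))) (E : SymTensor d) :
    ∃ g a, g 0 = (fun t => symDot E (G t E)) ∧ IsCMSequence g a (symDot E (Ginf E)) := by
  obtain ⟨G₀, hG₀⟩ := hG.finite_at_zero
  refine ⟨_, symDot E (G₀ E), ?_, (hG.completelyMonotonic E).isCMSequence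
    (((continuous_symDot E).tendsto _).comp (hG₀ E))
    (((continuous_symDot E).tendsto _).comp (hinf E))⟩
  ext t
  simp

theorem integrableOn_exp_mul_self (hG : IsSolidRelaxationModulus G) (E : SymTensor d) {p : ℝ}
    (hp : 0 < p) : IntegrableOn (fun t => Real.exp (-p * t) * symDot E (G t E)) (Ioi 0) := by
  obtain ⟨Ginf, hinf, -⟩ := hG.solid
  obtain ⟨g, a, hg0, hg⟩ := hG.exists_isCMSequence hinf E
  have := hg.integrableOn_exp_mul hp
  rwa [hg0] at this

theorem exp_mul_symDot_eq (hG : IsSolidRelaxationModulus G) (E C : SymTensor d) (p : ℝ) {t : ℝ}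
    (ht : 0 < t) : Real.exp (-p * t) * symDot E (G t C) =
      2⁻¹ * (Real.exp (-p * t) * symDot (E + C) (G t (E + C)) -
        Real.exp (-p * t) * symDot E (G t E) - Real.exp (-p * t) * symDot C (G t C)) := by
  rw [hG.symDot_eq_polarization ht]
  ring

theorem integrableOn_exp_mul (hG : IsSolidRelaxationModulus G) (E C : SymTensor d) {p : ℝ}
    (hp : 0 < p) : IntegrableOn (fun t => Real.exp (-p * t) * symDot E (G t C)) (Ioi 0) := by
  refine IntegrableOn.congr_fun ?_ (fun t ht => (hG.exp_mul_symDot_eq E C p ht).symm)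
    measurableSet_Ioi
  exact (((hG.integrableOn_exp_mul_self (E + C) hp).sub (hG.integrableOn_exp_mul_self E hp)).sub
    (hG.integrableOn_exp_mul_self C hp)).const_mul _

theorem integral_exp_mul (hG : IsSolidRelaxationModulus G) (E C : SymTensor d) {p : ℝ}
    (hp : 0 < p) : ∫ t in Ioi (0 : ℝ), Real.exp (-p * t) * symDot E (G t C) =
      2⁻¹ * ((∫ t in Ioi (0 : ℝ), Real.exp (-p * t) * symDot (E + C) (G t (E + C))) -
        (∫ t in Ioi (0 : ℝ), Real.exp (-p * t) * symDot E (G t E)) -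
        ∫ t in Ioi (0 : ℝ), Real.exp (-p * t) * symDot C (G t C)) := by
  have h1 := hG.integrableOn_exp_mul_self (E + C) hp
  have h2 := hG.integrableOn_exp_mul_self E hp
  have h3 := hG.integrableOn_exp_mul_self C hp
  rw [← integral_sub h1 h2, ← integral_sub ?_ h3, ← integral_const_mul]
  · exact setIntegral_congr_fun measurableSet_Ioi fun t ht => hG.exp_mul_symDot_eq E C p ht
  · exact h1.sub h2

theorem cexp_mul_eq (p t x : ℝ) :
    Complex.exp (-(p : ℂ) * t) * (x : ℂ) = ((Real.exp (-p * t) * x : ℝ) : ℂ) := by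
  push_cast
  rfl

theorem integrableOn_cexp_mul_component (hG : IsSolidRelaxationModulus G) {p : ℝ} (hp : 0 < p)
    (i j k l : Fin d) : IntegrableOn
      (fun t : ℝ => Complex.exp (-(p : ℂ) * t) * (component (G t) i j k l : ℂ)) (Ioi 0) := by
  simp only [cexp_mul_eq, component_eq_symDot]
  exact (hG.integrableOn_exp_mul _ _ hp).ofReal

theorem projectedModulus_apply (hG : IsSolidRelaxationModulus G) (n : EuclideanSpace ℝ (Fin d))
    {p : ℝ} (hp : 0 < p) (i k : Fin d) : projectedModulus G n p i k =
      (p * ∫ t in Ioi (0 : ℝ), Real.exp (-p * t) *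
        symDot (polarDyad n i) (G t (polarDyad n k)) : ℝ) := by
  have hI : ∀ j l, IntegrableOn (fun t : ℝ => Real.exp (-p * t) * component (G t) i j k l)
      (Ioi 0) := fun j l => by
    simp only [component_eq_symDot]
    exact hG.integrableOn_exp_mul _ _ hp
  have h1 : ∫ t in Ioi (0 : ℝ), Real.exp (-p * t) *
      symDot (polarDyad n i) (G t (polarDyad n k)) =
      ∑ j, ∑ l, (∫ t in Ioi (0 : ℝ), Real.exp (-p * t) * component (G t) i j k l) * n j * n l := by
    simp only [symDot_polarDyad, Finset.mul_sum, ← mul_assoc]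
    rw [integral_finsetSum _ fun j _ => integrable_finsetSum _ fun l _ =>
      ((hI j l).mul_const _).mul_const _]
    refine Finset.sum_congr rfl fun j _ => ?_
    rw [integral_finsetSum _ fun l _ => ((hI j l).mul_const _).mul_const _]
    refine Finset.sum_congr rfl fun l _ => ?_
    rw [integral_mul_const, integral_mul_const]
  rw [h1]
  simp only [projectedModulus, laplaceModulus, Matrix.of_apply, cexp_mul_eq,
    integral_complex_ofReal]
  push_cast
  simp only [Finset.mul_sum, mul_assoc]

open Matrix in
theorem exists_isSectorialFamily (hG : IsSolidRelaxationModulus G)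
    {n : EuclideanSpace ℝ (Fin d)} (hn : n ≠ 0) :
    ∃ Q γ, IsSectorialFamily Q γ ∧ ∀ p : ℝ, 0 < p → projectedModulus G n p = Q p := by
  obtain ⟨Ginf, hinf, hpos⟩ := hG.solid
  obtain ⟨γ, hγ, hle⟩ := exists_pos_le_symDot_polarTensor hn hpos
  have hnonneg : ∀ E, 0 ≤ symDot E (Ginf E) := fun E => by
    rcases eq_or_ne E 0 with rfl | hE
    · simp [symDot]
    · exact (hpos E hE).le
  have hq : ∀ E : SymTensor d, ∃ q : ℂ → ℂ, DifferentiableOn ℂ q Complex.slitPlane ∧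
      (∀ p : ℝ, 0 < p →
        q p = (p * ∫ t in Ioi (0 : ℝ), Real.exp (-p * t) * symDot E (G t E) : ℝ)) ∧
      (∀ z ∈ Complex.slitPlane,
        (slitSqrt z).re * symDot E (Ginf E) ≤ (conj (slitSqrt z) * q z).re) ∧
      ∀ z ∈ Complex.slitPlane, 0 ≤ ((z.im : ℂ) * Complex.I * conj z * q z).re := fun E => by
    obtain ⟨g, a, hg0, hg⟩ := hG.exists_isCMSequence hinf E
    have := hg.exists_continuation (hnonneg E)
    rwa [hg0] at this
  choose q hqd hqp hqre hqim using hq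
  -- The continuations `q E` are chosen separately for each `E`, so quadratic dependence on `E` is
  -- not automatic. Only finitely many of them define `Q`.
  obtain ⟨Q, hQ⟩ : ∃ Q : ℂ → Matrix (Fin d) (Fin d) ℂ, ∀ z i k, Q z i k =
      2⁻¹ * (q (polarDyad n i + polarDyad n k) z - q (polarDyad n i) z - q (polarDyad n k) z) :=
    ⟨fun z => of fun i k => _, fun _ _ _ => rfl⟩
  have hQp : ∀ p : ℝ, 0 < p → ∀ i k, Q p i k = (p * ∫ t in Ioi (0 : ℝ), Real.exp (-p * t) *
      symDot (polarDyad n i) (G t (polarDyad n k)) : ℝ) := fun p hp i k => by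
    rw [hQ, hqp _ p hp, hqp _ p hp, hqp _ p hp,
      hG.integral_exp_mul (polarDyad n i) (polarDyad n k) hp]
    push_cast
    ring
  have hQd : ∀ i k, DifferentiableOn ℂ (fun z => Q z i k) Complex.slitPlane := fun i k => by
    simp only [hQ]
    exact (((hqd _).sub (hqd _)).sub (hqd _)).const_mul _
  have hQsymm : ∀ z i k, Q z i k = Q z k i := fun z i k => by
    rw [hQ, hQ, add_comm (polarDyad n i)]
    ring
  -- Both sides are holomorphic and agree on the positive axis, where `q` is an honest integral;
  -- this transfers the sector inequalities of `q` to `Q`.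
  have hquad : ∀ a : Fin d → ℝ, ∀ z ∈ Complex.slitPlane,
      ∑ i, ∑ k, (a i : ℂ) * a k * Q z i k = q (polarTensor n a) z := fun a => by
    refine eqOn_slitPlane_of_eq_on_pos ?_ (hqd _) fun p hp => ?_
    · exact DifferentiableOn.fun_sum fun i _ => DifferentiableOn.fun_sum fun k _ =>
        (hQd i k).const_mul _
    · simp only [hQp p hp]
      rw [hqp _ p hp]
      norm_cast
      have hI : ∀ i k, IntegrableOn (fun t : ℝ => a i * a k * (Real.exp (-p * t) *
          symDot (polarDyad n i) (G t (polarDyad n k)))) (Ioi 0) := fun i k =>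
        (hG.integrableOn_exp_mul _ _ hp).const_mul _
      have h1 : ∫ t in Ioi (0 : ℝ), Real.exp (-p * t) *
          symDot (polarTensor n a) (G t (polarTensor n a)) =
          ∑ i, ∑ k, a i * a k * ∫ t in Ioi (0 : ℝ), Real.exp (-p * t) *
            symDot (polarDyad n i) (G t (polarDyad n k)) := by
        simp only [symDot_polarTensor, Finset.mul_sum, mul_left_comm (Real.exp _)]
        rw [integral_finsetSum _ fun i _ => integrable_finsetSum _ fun k _ => hI i k]
        refine Finset.sum_congr rfl fun i _ => ?_
        rw [integral_finsetSum _ fun k _ => hI i k]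
        refine Finset.sum_congr rfl fun k _ => ?_
        rw [integral_const_mul]
      rw [h1, Finset.mul_sum]
      refine Finset.sum_congr rfl fun i _ => ?_
      rw [Finset.mul_sum]
      exact Finset.sum_congr rfl fun k _ => by ring
  -- `Q z` is complex symmetric, in general not Hermitian; symmetry cancels the cross terms between
  -- real and imaginary parts of `v`, leaving two real directions.
  have hform : ∀ z ∈ Complex.slitPlane, ∀ v : Fin d → ℂ, star v ⬝ᵥ Q z *ᵥ v =
      q (polarTensor n fun i => (v i).re) z + q (polarTensor n fun i => (v i).im) z := by
    intro z hz v
    rw [← hquad _ z hz, ← hquad _ z hz]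
    have h0 : ∑ i, ∑ k, (((v i).re : ℂ) * (v k).im * Q z i k) =
        ∑ i, ∑ k, (((v i).im : ℂ) * (v k).re * Q z i k) := by
      rw [Finset.sum_comm]
      refine Finset.sum_congr rfl fun i _ => Finset.sum_congr rfl fun k _ => ?_
      rw [hQsymm]
      ring
    have h1 : star v ⬝ᵥ Q z *ᵥ v = ∑ i, ∑ k, (((v i).re : ℂ) * (v k).re * Q z i k +
        ((v i).im : ℂ) * (v k).im * Q z i k + Complex.I * (((v i).re : ℂ) * (v k).im * Q z i k) -
        Complex.I * (((v i).im : ℂ) * (v k).re * Q z i k)) := by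
      simp only [dotProduct, mulVec, Finset.mul_sum, Pi.star_apply]
      refine Finset.sum_congr rfl fun i _ => Finset.sum_congr rfl fun k _ => ?_
      have e1 : star (v i) = (v i).re - (v i).im * Complex.I :=
        Complex.ext (by simp) (by simp)
      have e2 : v k = (v k).re + (v k).im * Complex.I := (Complex.re_add_im (v k)).symm
      rw [e1]
      conv_lhs => rw [e2]
      linear_combination (-((v i).im : ℂ) * (v k).im * Q z i k) * Complex.I_mul_I
    rw [h1]
    simp only [Finset.sum_add_distrib, Finset.sum_sub_distrib, ← Finset.mul_sum]
    rw [h0]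
    ring
  refine ⟨Q, γ, ⟨hγ, hQd, fun z hz v => ?_, fun z hz v => ?_, fun p hp => ?_, fun p hp i k => ?_⟩,
    fun p hp => ?_⟩
  · rw [hform z hz, mul_add, Complex.add_re]
    refine le_trans ?_ (add_le_add (hqre _ z hz) (hqre _ z hz))
    rw [← mul_add]
    refine mul_le_mul_of_nonneg_left ?_ (slitSqrt_re_pos hz).le
    refine le_trans (le_of_eq ?_) (add_le_add (hle _) (hle _))
    rw [← mul_add, ← Finset.sum_add_distrib]
    congr 1
    refine Finset.sum_congr rfl fun i _ => ?_
    rw [Complex.sq_norm, Complex.normSq_apply]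
    ring
  · rw [hform z hz, mul_add, Complex.add_re]
    exact add_nonneg (hqim _ z hz) (hqim _ z hz)
  · ext i k
    rw [conjTranspose_apply, hQp p hp k i, Complex.star_def, Complex.conj_ofReal, ← hQp p hp,
      hQsymm]
  · rw [hQp p hp, Complex.ofReal_im]
  · ext i k
    rw [hG.projectedModulus_apply n hp, hQp p hp]

end IsSolidRelaxationModulus

theorem mainTheorem2 {d : ℕ} (ρ : ℝ) (hρ : 0 < ρ) (G : ℝ → SymTensor d →ₗ[ℝ] SymTensor d)
    (hG : IsSolidRelaxationModulus G) (n : EuclideanSpace ℝ (Fin d)) (hn : ‖n‖ = 1) :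
    (∀ p : ℝ, 0 < p →
      (∀ i j k l : Fin d, IntegrableOn
        (fun t : ℝ => Complex.exp (-(p : ℂ) * t) * (component (G t) i j k l : ℂ)) (Ioi 0)) ∧
      IsPrincipalSqrt (projectedModulus G n p) (principalSqrt (projectedModulus G n p))) ∧
    IsMatrixCBF (fun p : ℝ => wavenumber ρ G n p) := by
  have hn0 : n ≠ 0 := norm_ne_zero_iff.1 (by rw [hn]; exact one_ne_zero)
  obtain ⟨Q, γ, hQ, hQp⟩ := hG.exists_isSectorialFamily hn0
  refine ⟨fun p hp => ⟨hG.integrableOn_cexp_mul_component hp, ?_⟩, ?_⟩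
  · rw [hQp p hp]
    exact hQ.isPrincipalSqrt hp
  · refine hQ.isMatrixCBF (Real.sqrt_nonneg ρ) (by simp [wavenumber]) fun p hp => ?_
    rw [wavenumber, hQp p hp]
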